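/- Let $A$ be a weak Kac algebra, i.e. a finite dimensional weak $C^*$-Hopf algebra (in the sense of Böhm–Nill–Szlachányi) with coproduct $\Delta$, counit $\varepsilon$ and antipode $S$ satisfying $S^2=\mathrm{id}$. Put $\sqcap^L(x)=\varepsilon(1_{(1)}x)1_{(2)}$, $\sqcap^R(x)=1_{(1)}\varepsilon(x1_{(2)})$, $A^L=\sqcap^L(A)$, $A^R=\sqcap^R(A)$, $Z^L=A^L\cap\mathrm{Center}\,A$ and $\mathrm{Hypercenter}\,A=A^L\cap A^R\cap\mathrm{Center}\,A$; let $z_H$, $H\in\mathrm{Hyp}\,A$, be the minimal projections of the hypercenter. A vacuum $\mu$ is an irreducible representation of $A$ that occurs in the trivial representation $V_\varepsilon$ (the GNS representation of $\varepsilon$); $z^L_\mu$ is the minimal projection of $Z^L$ that acts on $V_\varepsilon$ as the projection onto the component $\mu$, and $[\mu]\in\mathrm{Hyp}\,A$ is determined by $z_{[\mu]}z^L_\mu=z^L_\mu$. Let $\hat h\colon A\to\mathbb C$ be the Haar functional (the normalized two-sided integral of the dual of $A$), and let $E^L(x)=x_{(1)}\hat h(x_{(2)})$, $E^R(x)=\hat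 h(x_{(1)})x_{(2)}$ be the Haar conditional expectations onto $A^L$ and $A^R$. Let $\tau_M$ be the Markov trace: the faithful positive trace with $\tau_M(z_H)=1$ for all $H$ which is a Markov trace for both inclusions $A^L\subset A$ and $A^R\subset A$, i.e. for each of them, on every connected component, the trace vector of $\tau_M$ is a Perron–Frobenius eigenvector of $\Lambda\Lambda^t$, where $\Lambda$ is the inclusion matrix. Let $E^L_M$, $E^R_M$ be the $\tau_M$-preserving conditional expectations onto $A^L$, $A^R$. Then $\hat h$ and $\tau_M$ exist, and the following hold. 1. The (Watatani) indices of the Haar and of the Markov conditional expectations coincide and are hypercentral: $\mathrm{Index}\,E^L=\mathrm{Index}\,E^R=I_H=I_M=\mathrm{Index}\,E^L_M=\mathrm{Index}\,E^R_M\in\mathrm{Hypercenter}\,A$. On each hypercentral block $z_HA$ this index is a natural number multiple of $z_H$. 2. For each vacuum $\mu$, $\dim z^L_\mu A$ is divisible by $\dim z^L_\mu A^L\neq0$, and the ratio is the value of $I_H=I_M$ on the hypercentral block $[\mu]$; in particular the ratio is constant over the block. 3. If $A$ is pure, i.e. $V_\varepsilon$ is irreducible, then $\dim A^L$ divides $\dim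 A$. -/

import Mathlib

open TensorProduct Coalgebra
open scoped ComplexOrder

noncomputable section

namespace WeakKac

section WeakHopf

variable (A : Type*) [Ring A] [Algebra ℂ A] [Coalgebra ℂ A]

/-- The map `Π^L(x) = ε(1₍₁₎ x) 1₍₂₎`. -/
def piL : A →ₗ[ℂ] A where
  toFun x := TensorProduct.lid ℂ A
    (LinearMap.rTensor A (counit (R := ℂ) ∘ₗ LinearMap.mulRight ℂ x) (comul (R := ℂ) (1 : A)))
  map_add' x y := by
    have : LinearMap.mulRight ℂ (x + y) = LinearMap.mulRight ℂ x + LinearMap.mulRight ℂ y := by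
      ext; simp [mul_add]
    simp [this, LinearMap.comp_add, LinearMap.rTensor_add]
  map_smul' c x := by
    have : LinearMap.mulRight ℂ (c • x) = c • LinearMap.mulRight ℂ x := by ext; simp
    simp [this, LinearMap.comp_smul, LinearMap.rTensor_smul]

/-- The map `Π^R(x) = 1₍₁₎ ε(x 1₍₂₎)`. -/
def piR : A →ₗ[ℂ] A where
  toFun x := TensorProduct.rid ℂ A
    (LinearMap.lTensor A (counit (R := ℂ) ∘ₗ LinearMap.mulLeft ℂ x) (comul (R := ℂ) (1 : A)))
  map_add' x y := by
    have : LinearMap.mulLeft ℂ (x + y) = LinearMap.mulLeft ℂ x + LinearMap.mulLeft ℂ y := by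
      ext; simp [add_mul]
    simp [this, LinearMap.comp_add, LinearMap.lTensor_add]
  map_smul' c x := by
    have : LinearMap.mulLeft ℂ (c • x) = c • LinearMap.mulLeft ℂ x := by ext; simp
    simp [this, LinearMap.comp_smul, LinearMap.lTensor_smul]

/-- A weak Hopf algebra structure (Böhm–Nill–Szlachányi) on an algebra that is also a coalgebra:
the coproduct is multiplicative (but need not preserve the unit), the counit is weakly
multiplicative, the unit is weakly comultiplicative, and there is an antipode. -/
class WeakHopfAlgebra where
  /-- `Δ(xy) = Δ(x)Δ(y)` -/
  comul_mul : ∀ x y : A, comul (R := ℂ) (x * y) = comul (R := ℂ) x * comul (R := ℂ) y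
  /-- `ε(xyz) = ε(x y₍₁₎) ε(y₍₂₎ z)` -/
  counit_mul_mul : ∀ x y z : A, counit (R := ℂ) (x * y * z) =
    LinearMap.mul' ℂ ℂ (TensorProduct.map (counit (R := ℂ) ∘ₗ LinearMap.mulLeft ℂ x)
      (counit (R := ℂ) ∘ₗ LinearMap.mulRight ℂ z) (comul (R := ℂ) y))
  /-- `ε(xyz) = ε(x y₍₂₎) ε(y₍₁₎ z)` -/
  counit_mul_mul' : ∀ x y z : A, counit (R := ℂ) (x * y * z) =
    LinearMap.mul' ℂ ℂ (TensorProduct.map (counit (R := ℂ) ∘ₗ LinearMap.mulRight ℂ z)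
      (counit (R := ℂ) ∘ₗ LinearMap.mulLeft ℂ x) (comul (R := ℂ) y))
  /-- `(Δ ⊗ id)(Δ(1)) = (Δ(1) ⊗ 1)(1 ⊗ Δ(1))` -/
  comul_comul_one : LinearMap.rTensor A (comul (R := ℂ)) (comul (R := ℂ) (1 : A)) =
    (comul (R := ℂ) (1 : A) ⊗ₜ[ℂ] (1 : A)) *
      (TensorProduct.assoc ℂ A A A).symm ((1 : A) ⊗ₜ[ℂ] comul (R := ℂ) (1 : A))
  /-- `(Δ ⊗ id)(Δ(1)) = (1 ⊗ Δ(1))(Δ(1) ⊗ 1)` -/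
  comul_comul_one' : LinearMap.rTensor A (comul (R := ℂ)) (comul (R := ℂ) (1 : A)) =
    (TensorProduct.assoc ℂ A A A).symm ((1 : A) ⊗ₜ[ℂ] comul (R := ℂ) (1 : A)) *
      (comul (R := ℂ) (1 : A) ⊗ₜ[ℂ] (1 : A))
  /-- The antipode `S`. -/
  antipode : A →ₗ[ℂ] A
  /-- `x₍₁₎ S(x₍₂₎) = Π^L(x)` -/
  mul_antipode : ∀ x : A,
    LinearMap.mul' ℂ A (LinearMap.lTensor A antipode (comul (R := ℂ) x)) = piL A x
  /-- `S(x₍₁₎) x₍₂₎ = Π^R(x)` -/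
  antipode_mul : ∀ x : A,
    LinearMap.mul' ℂ A (LinearMap.rTensor A antipode (comul (R := ℂ) x)) = piR A x
  /-- `S(x₍₁₎) x₍₂₎ S(x₍₃₎) = S(x)` -/
  antipode_mul_antipode : ∀ x : A,
    LinearMap.mul' ℂ A (TensorProduct.map
      (LinearMap.mul' ℂ A ∘ₗ LinearMap.rTensor A antipode ∘ₗ comul (R := ℂ)) antipode
      (comul (R := ℂ) x)) = antipode x

/-- The left subalgebra `A^L = Π^L(A)`. -/
def leftSub : Submodule ℂ A := LinearMap.range (piL A)

/-- The right subalgebra `A^R = Π^R(A)`. -/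
def rightSub : Submodule ℂ A := LinearMap.range (piR A)

/-- The centre of `A`, as a subspace. -/
def centerSub : Submodule ℂ A := Subalgebra.toSubmodule (Subalgebra.center ℂ A)

/-- `Z^L = A^L ∩ Center A`. -/
def zL : Submodule ℂ A := leftSub A ⊓ centerSub A

/-- `Hypercenter A = A^L ∩ A^R ∩ Center A`. -/
def hypercenter : Submodule ℂ A := leftSub A ⊓ rightSub A ⊓ centerSub A

variable {A}

/-- The arrow `x ⇀ φ` of `A` on functionals: `(x ⇀ φ)(y) = φ(y x)`. -/
def arrow (x : A) (φ : Module.Dual ℂ A) : Module.Dual ℂ A := φ ∘ₗ LinearMap.mulRight ℂ x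

/-- The product of the dual algebra: `(φ ψ)(x) = φ(x₍₁₎) ψ(x₍₂₎)`. -/
def dualMul (φ ψ : Module.Dual ℂ A) : Module.Dual ℂ A :=
  LinearMap.mul' ℂ ℂ ∘ₗ TensorProduct.map φ ψ ∘ₗ comul (R := ℂ)

/-- `h` is the Haar integral of the dual weak Hopf algebra, i.e. the Haar functional on `A`:
a two-sided integral, `φ h = Π̂^L(φ) h` and `h φ = h Π̂^R(φ)`, which is normalized,
`Π̂^L(h) = 1̂ = Π̂^R(h)`. In the dual weak Hopf algebra `1̂ = ε`,
`Π̂^L(φ) = φ ∘ Π^L` and `Π̂^R(φ) = φ ∘ Π^R`. -/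
structure IsHaarFunctional (h : Module.Dual ℂ A) : Prop where
  left_integral : ∀ φ : Module.Dual ℂ A, dualMul φ h = dualMul (φ ∘ₗ piL A) h
  right_integral : ∀ φ : Module.Dual ℂ A, dualMul h φ = dualMul h (φ ∘ₗ piR A)
  left_normalized : h ∘ₗ piL A = counit (R := ℂ)
  right_normalized : h ∘ₗ piR A = counit (R := ℂ)

/-- `E^L(x) = h ⇀ x = x₍₁₎ h(x₍₂₎)`. -/
def haarEL (h : Module.Dual ℂ A) : A →ₗ[ℂ] A :=
  (TensorProduct.rid ℂ A).toLinearMap ∘ₗ LinearMap.lTensor A h ∘ₗ comul (R := ℂ)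

/-- `E^R(x) = x ↼ h = h(x₍₁₎) x₍₂₎`. -/
def haarER (h : Module.Dual ℂ A) : A →ₗ[ℂ] A :=
  (TensorProduct.lid ℂ A).toLinearMap ∘ₗ LinearMap.rTensor A h ∘ₗ comul (R := ℂ)

variable (A)

/-- The trivial left `A`-module `V_ε = {x ⇀ ε : x ∈ A}` (the module of the GNS representation of
the counit), with action `arrow`. -/
def trivialRep : Submodule ℂ (Module.Dual ℂ A) :=
  LinearMap.range ({ toFun := fun x => arrow x (counit (R := ℂ))
                     map_add' := by intros; ext; simp [arrow, mul_add]
                     map_smul' := by intros; ext; simp [arrow] } : A →ₗ[ℂ] Module.Dual ℂ A)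

/-- `A` is pure: the trivial representation `V_ε` is irreducible. -/
def IsPure : Prop :=
  trivialRep A ≠ ⊥ ∧ ∀ W : Submodule ℂ (Module.Dual ℂ A), W ≤ trivialRep A →
    (∀ (x : A), ∀ φ ∈ W, arrow x φ ∈ W) → W = ⊥ ∨ W = trivialRep A

end WeakHopf

section CStar

variable {A : Type*} [CStarAlgebra A]

/-- `p` is a minimal projection of (the *-subalgebra) `B`. -/
def IsMinProj (B : Submodule ℂ A) (p : A) : Prop :=
  p ∈ B ∧ IsStarProjection p ∧ p ≠ 0 ∧
    ∀ q ∈ B, IsStarProjection q → q * p = q → q = 0 ∨ q = p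

/-- `e` lists one minimal projection out of each simple block of the *-subalgebra `B`. -/
structure IsSectorSystem (B : Submodule ℂ A) {n : ℕ} (e : Fin n → A) : Prop where
  minimal : ∀ i, IsMinProj B (e i)
  inequivalent : ∀ i j, i ≠ j → ∀ x ∈ B, e i * x * e j = 0
  exhaustive : ∀ p, IsMinProj B p → ∃ i, ∃ x ∈ B, p * x * e i ≠ 0

/-- The entry of the inclusion matrix of `B ⊆ A` at the block of the minimal projection `e` of `A`
and the block of the minimal projection `f` of `B`: the multiplicity of the simple `B`-module `B f`
in the simple `A`-module `A e`, i.e. `dim Hom_B(B f, A e) = dim (f A e)`. -/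
def inclusionMult (e f : A) : ℕ :=
  Module.finrank ℂ (LinearMap.range (LinearMap.mulLeft ℂ f ∘ₗ LinearMap.mulRight ℂ e))

/-- `τ` is a faithful positive trace on `A`. -/
structure IsFaithfulTrace (τ : A →ₗ[ℂ] ℂ) : Prop where
  trace : ∀ x y, τ (x * y) = τ (y * x)
  faithful : ∀ x, x ≠ 0 → 0 < τ (star x * x)

/-- `τ` is a Markov trace for the inclusion `B ⊆ A`: a faithful trace such that on every
connected component (minimal projection `z` of `Center A ∩ Center B = B ∩ Center A`) its trace
vector `t_i = τ(e_i)`, which is positive, is a Perron–Frobenius eigenvector of `Λ Λᵗ`, where `Λ` is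
the inclusion matrix. -/
structure IsMarkovTraceFor (B : Submodule ℂ A) (τ : A →ₗ[ℂ] ℂ) : Prop where
  isFaithfulTrace : IsFaithfulTrace τ
  perron_frobenius : ∀ (n m : ℕ) (e : Fin n → A) (f : Fin m → A),
    IsSectorSystem (⊤ : Submodule ℂ A) e → IsSectorSystem B f →
    ∀ z, IsMinProj (B ⊓ Subalgebra.toSubmodule (Subalgebra.center ℂ A)) z →
      ∃ r : ℂ, ∀ i, z * e i = e i →
        ∑ i', (∑ j, (inclusionMult (e i) (f j) : ℂ) * (inclusionMult (e i') (f j) : ℂ)) * τ (e i')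
          = r * τ (e i)

/-- `E` is a conditional expectation of `A` onto the unital *-subalgebra `B`. -/
structure IsCondExp (B : Submodule ℂ A) (E : A →ₗ[ℂ] A) : Prop where
  mem : ∀ x, E x ∈ B
  apply_of_mem : ∀ b ∈ B, E b = b
  bimodule : ∀ b ∈ B, ∀ c ∈ B, ∀ x, E (b * x * c) = b * E x * c
  positive : ∀ x, ∃ y, E (star x * x) = star y * y

/-- `E` is a conditional expectation onto `B` with Watatani index `I`: there is a quasi-basis
`∑ aᵢ ⊗ bᵢ` of `E`, and `I = ∑ aᵢ bᵢ` (this sum is the same for every quasi-basis). -/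
def HasIndex (B : Submodule ℂ A) (E : A →ₗ[ℂ] A) (I : A) : Prop :=
  IsCondExp B E ∧ ∃ (n : ℕ) (a b : Fin n → A),
    (∀ x, ∑ i, a i * E (b i * x) = x) ∧ (∀ x, ∑ i, E (x * a i) * b i = x) ∧
    I = ∑ i, a i * b i

/-- `E` is a `τ`-preserving conditional expectation onto `B`. -/
def IsPreservingCondExp (B : Submodule ℂ A) (τ : A →ₗ[ℂ] ℂ) (E : A →ₗ[ℂ] A) : Prop :=
  IsCondExp B E ∧ ∀ b ∈ B, ∀ x, τ (b * E x) = τ (b * x)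

variable (A) [Coalgebra ℂ A]

/-- A weak Kac algebra: a finite dimensional weak C*-Hopf algebra (a weak Hopf algebra on a
finite dimensional C*-algebra whose coproduct is a *-map) with involutive antipode. -/
class WeakKacAlgebra extends WeakHopfAlgebra A where
  finiteDimensional : FiniteDimensional ℂ A
  comul_star : ∀ x : A, comul (R := ℂ) (star x) = star (comul (R := ℂ) x)
  antipode_antipode : ∀ x : A, antipode (antipode x) = x

variable {A}

/-- `e` is the minimal central projection `e_q` of a sector `q` of `A`. -/
def IsSector (e : A) : Prop := IsMinProj (centerSub A) e

/-- `e` is the minimal central projection of a vacuum: a sector that occurs in `V_ε`, i.e. `e`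
acts on `V_ε` by a nonzero operator. -/
def IsVacuum (e : A) : Prop := IsSector e ∧ ∃ φ ∈ trivialRep A, arrow e φ ≠ 0

/-- `z = z_μ^L` for the vacuum `μ` with minimal central projection `e`: the minimal projection of
`Z^L` that acts on `V_ε` as `e` does (it is unique, as `V_ε` is a faithful `A^L`-module), i.e. as the projection onto the component `μ` of `V_ε`. -/
def IsLeftVacuumProj (e z : A) : Prop :=
  IsMinProj (zL A) z ∧ ∀ φ ∈ trivialRep A, arrow z φ = arrow e φ

/-- `H` is the minimal hypercentral projection `z_H` of a hyperselection sector. -/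
def IsHyperSector (H : A) : Prop := IsMinProj (hypercenter A) H

/-- `τ` is the Markov trace of `A`: the common Markov trace of the inclusions `A^L ⊆ A` and
`A^R ⊆ A`, normalized by `τ(z_H) = 1` on every hyperselection sector. -/
structure IsMarkovTrace (τ : A →ₗ[ℂ] ℂ) : Prop where
  left : IsMarkovTraceFor (leftSub A) τ
  right : IsMarkovTraceFor (rightSub A) τ
  normalized : ∀ H, IsHyperSector H → τ H = 1

end CStar

end WeakKac

end

/-!
Let `χ` be the trace of the regular representation. The map `x ↦ x₍₁₎ χ(x₍₂₎)` takes values in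
`A^L`, and its value `K` at `1` is hypercentral. On each hypercentral block `K` is a scalar,
positive because `χ(K p)` is the rank of the idempotent `Δ(1)(p ⊗ 1)`. Hence `K` is invertible,
`h = χ(K⁻¹ ·)` is the Haar functional, and `E^L`, `E^R` are `h`-preserving conditional expectations.
Since `h` restricts to the regular traces of `A^L` and `A^R`, these expectations have index `K`.

Counting dimensions of corners shows that `Λ Λᵗ` maps the trace vector of `h` to that of `h(K ·)`.
So on each connected component every trace `h(k ·)` with `k` hypercentral is Perron–Frobenius, and
the scalar `K` is at once an eigenvalue of an integral matrix and a ratio of dimensions, that is, a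
natural number. Conversely, if `h(k ·)` is a Markov trace, testing the eigenvalue equation against
`1` and `k` gives `h(|k - E(k)|²) = 0`. So `k` lies in the subalgebra, and the expectation that
preserves `h(k ·)` is the Haar one.

A vacuum with central projection `e` has `z^L = Π^L(e)`.
-/

open TensorProduct Coalgebra
open scoped ComplexOrder
open WeakKac.WeakHopfAlgebra (antipode)

noncomputable section

namespace WeakKac

local notation "Δ" => comul (R := ℂ)
local notation "ε" => counit (R := ℂ)

/-- The convolution product `x ↦ f(x₍₁₎) g(x₍₂₎)`, as an operation on plain linear maps rather than
on the type synonym `WithConv`. -/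
def conv {R C B : Type*} [CommSemiring R] [AddCommMonoid C] [Module R C] [Coalgebra R C]
    [Semiring B] [Algebra R B] (f g : C →ₗ[R] B) : C →ₗ[R] B :=
  (WithConv.toConv f * WithConv.toConv g).ofConv

local infixl:70 " ⋆ " => conv

section Convolution

variable {R C B : Type*} [CommSemiring R] [AddCommMonoid C] [Module R C] [Coalgebra R C]
  [Semiring B] [Algebra R B]

lemma conv_apply (f g : C →ₗ[R] B) (x : C) :
    (f ⋆ g) x = ∑ i ∈ (ℛ R x).index, f ((ℛ R x).left i) * g ((ℛ R x).right i) :=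
  (ℛ R x).convMul_apply (WithConv.toConv f) (WithConv.toConv g)

lemma conv_apply_of_comul_eq {x : C} {t : C ⊗[R] C} (h : comul x = t) (f g : C →ₗ[R] B) :
    (f ⋆ g) x = LinearMap.mul' R B (TensorProduct.map f g t) := by rw [← h]; rfl

lemma conv_assoc (f g h : C →ₗ[R] B) : f ⋆ g ⋆ h = f ⋆ (g ⋆ h) :=
  congrArg WithConv.ofConv (mul_assoc (WithConv.toConv f) (WithConv.toConv g) (WithConv.toConv h))

lemma mulLeft_comp_conv (b : B) (f g : C →ₗ[R] B) :
    (LinearMap.mulLeft R b ∘ₗ f) ⋆ g = LinearMap.mulLeft R b ∘ₗ (f ⋆ g) := by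
  ext x; simp [conv_apply, mul_assoc]

lemma conv_mulRight_comp (b : B) (f g : C →ₗ[R] B) :
    f ⋆ (LinearMap.mulRight R b ∘ₗ g) = LinearMap.mulRight R b ∘ₗ (f ⋆ g) := by
  ext x; simp [conv_apply, mul_assoc]

lemma mulRight_comp_conv (b : B) (f g : C →ₗ[R] B) :
    (LinearMap.mulRight R b ∘ₗ f) ⋆ g = f ⋆ (LinearMap.mulLeft R b ∘ₗ g) := by
  ext x; simp [conv_apply, mul_assoc]

lemma algHom_comp_conv {B' : Type*} [Semiring B'] [Algebra R B'] (φ : B →ₐ[R] B')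
    (f g : C →ₗ[R] B) :
    φ.toLinearMap ∘ₗ (f ⋆ g) = (φ.toLinearMap ∘ₗ f) ⋆ (φ.toLinearMap ∘ₗ g) :=
  LinearMap.algHom_comp_convMul_distrib φ (WithConv.toConv f) (WithConv.toConv g)

lemma conv_tmul {D : Type*} [AddCommMonoid D] [Module R D] [Coalgebra R D]
    (f g : C ⊗[R] D →ₗ[R] B) (x : C) (y : D) :
    (f ⋆ g) (x ⊗ₜ y) = ∑ i ∈ (ℛ R x).index, ∑ j ∈ (ℛ R y).index,
      f ((ℛ R x).left i ⊗ₜ (ℛ R y).left j) * g ((ℛ R x).right i ⊗ₜ (ℛ R y).right j) := by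
  rw [conv_apply_of_comul_eq (TensorProduct.comul_tmul x y), ← (ℛ R x).eq, ← (ℛ R y).eq]
  simp only [TensorProduct.sum_tmul, TensorProduct.tmul_sum, map_sum]
  rw [Finset.sum_comm]
  simp

lemma conv_includeLeft_includeRight {B' : Type*} [Semiring B'] [Algebra R B'] (f : C →ₗ[R] B)
    (g : C →ₗ[R] B') :
    ((Algebra.TensorProduct.includeLeft : B →ₐ[R] B ⊗[R] B').toLinearMap ∘ₗ f) ⋆
      (Algebra.TensorProduct.includeRight.toLinearMap ∘ₗ g) =
        TensorProduct.map f g ∘ₗ comul := by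
  ext x
  rw [LinearMap.comp_apply, ← (ℛ R x).eq]
  simp [conv_apply]

lemma conv_includeLeft_includeRight_eq_comul [Coalgebra R B] :
    (Algebra.TensorProduct.includeLeft : B →ₐ[R] B ⊗[R] B).toLinearMap ⋆
      Algebra.TensorProduct.includeRight.toLinearMap = comul := by
  simpa [TensorProduct.map_id] using
    conv_includeLeft_includeRight (R := R) (C := B) (B := B) (B' := B) .id .id

/-- Uniqueness of generalized inverses in the convolution semigroup. -/
lemma eq_of_conv_eq {f g m : C →ₗ[R] B} (hf : f ⋆ m ⋆ f = f) (hg : g ⋆ m ⋆ g = g)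
    (hl : f ⋆ m = g ⋆ m) (hr : m ⋆ f = m ⋆ g) : f = g := by
  rw [← hf, hl, conv_assoc, hr, ← conv_assoc, hg]

end Convolution

section TensorProduct

variable {R B : Type*} [CommSemiring R] [Semiring B] [Algebra R B]

lemma assoc_tmul_one_mul (a b : B) (s : B ⊗[R] B) :
    TensorProduct.assoc R B B B ((a ⊗ₜ b) ⊗ₜ 1 * (TensorProduct.assoc R B B B).symm (1 ⊗ₜ s)) =
      a ⊗ₜ[R] ((b ⊗ₜ 1) * s) := by
  induction s with
  | zero => simp
  | tmul c d => simp
  | add s t hs ht => simp only [TensorProduct.tmul_add, map_add, mul_add, hs, ht]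

lemma assoc_mul_tmul_one (a b : B) (s : B ⊗[R] B) :
    TensorProduct.assoc R B B B ((TensorProduct.assoc R B B B).symm (1 ⊗ₜ s) * (a ⊗ₜ b) ⊗ₜ 1) =
      a ⊗ₜ[R] (s * (b ⊗ₜ 1)) := by
  induction s with
  | zero => simp
  | tmul c d => simp
  | add s t hs ht => simp only [TensorProduct.tmul_add, map_add, add_mul, hs, ht]

end TensorProduct

section WeakHopf

variable {A : Type*} [Ring A] [Algebra ℂ A] [Coalgebra ℂ A]

/-- A Sweedler decomposition `∑ 1₍₁₎ ⊗ 1₍₂₎` of `Δ(1)`, fixed once and for all. -/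
local notation "𝟙" => ℛ ℂ (1 : A)

lemma comul_one_mul_tmul (a b : A) :
    Δ (1 : A) * (a ⊗ₜ b) = ∑ i ∈ 𝟙.index, (𝟙.left i * a) ⊗ₜ[ℂ] (𝟙.right i * b) := by
  simp [← 𝟙.eq, Finset.sum_mul]

lemma tmul_mul_comul_one (a b : A) :
    (a ⊗ₜ b) * Δ (1 : A) = ∑ i ∈ 𝟙.index, (a * 𝟙.left i) ⊗ₜ[ℂ] (b * 𝟙.right i) := by
  simp [← 𝟙.eq, Finset.mul_sum]

lemma piL_apply (x : A) : piL A x = ∑ i ∈ 𝟙.index, ε (𝟙.left i * x) • 𝟙.right i := by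
  simp [piL, ← 𝟙.eq]

lemma piR_apply (x : A) : piR A x = ∑ i ∈ 𝟙.index, ε (x * 𝟙.right i) • 𝟙.left i := by
  simp [piR, ← 𝟙.eq]

/-- The map `x ↦ 1₍₁₎ ε(1₍₂₎ x)`, which composed with the antipode gives `Π^L`. -/
def piRbar : A →ₗ[ℂ] A :=
  ∑ i ∈ 𝟙.index, (ε ∘ₗ LinearMap.mulLeft ℂ (𝟙.right i)).smulRight (𝟙.left i)

/-- The map `x ↦ ε(x 1₍₁₎) 1₍₂₎`, which composed with the antipode gives `Π^R`. -/
def piLbar : A →ₗ[ℂ] A :=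
  ∑ i ∈ 𝟙.index, (ε ∘ₗ LinearMap.mulRight ℂ (𝟙.left i)).smulRight (𝟙.right i)

lemma piRbar_apply (x : A) : piRbar x = ∑ i ∈ 𝟙.index, ε (𝟙.right i * x) • 𝟙.left i := by
  simp [piRbar]

lemma piLbar_apply (x : A) : piLbar x = ∑ i ∈ 𝟙.index, ε (x * 𝟙.left i) • 𝟙.right i := by
  simp [piLbar]

lemma piL_one : piL A (1 : A) = 1 := by
  simpa only [piL_apply, mul_one] using Coalgebra.sum_counit_smul 𝟙

lemma piR_one : piR A (1 : A) = 1 := by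
  have h := congrArg (TensorProduct.rid ℂ A) (Coalgebra.sum_tmul_counit_eq 𝟙)
  simpa only [map_sum, TensorProduct.rid_tmul, one_smul, piR_apply, one_mul] using h

variable [WeakHopfAlgebra A]

lemma comul_mul (x y : A) : Δ (x * y) = Δ x * Δ y := WeakHopfAlgebra.comul_mul x y

lemma comul_one_mul_comul (x : A) : Δ (1 : A) * Δ x = Δ x := by rw [← comul_mul, one_mul]

lemma comul_mul_comul_one (x : A) : Δ x * Δ (1 : A) = Δ x := by rw [← comul_mul, mul_one]

/-! ### The counital maps -/

lemma sum_comul_tmul_one : ∑ i ∈ 𝟙.index, Δ (𝟙.left i) ⊗ₜ[ℂ] 𝟙.right i =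
    ∑ i ∈ 𝟙.index, (Δ (1 : A) * (1 ⊗ₜ 𝟙.left i)) ⊗ₜ[ℂ] 𝟙.right i := by
  have h := WeakHopfAlgebra.comul_comul_one (A := A)
  conv_lhs at h => rw [← 𝟙.eq]
  conv_rhs at h => enter [2]; rw [← 𝟙.eq]
  simpa [TensorProduct.tmul_sum, Finset.mul_sum] using h

lemma sum_comul_tmul_one' : ∑ i ∈ 𝟙.index, Δ (𝟙.left i) ⊗ₜ[ℂ] 𝟙.right i =
    ∑ i ∈ 𝟙.index, ((1 ⊗ₜ 𝟙.left i) * Δ (1 : A)) ⊗ₜ[ℂ] 𝟙.right i := by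
  have h := WeakHopfAlgebra.comul_comul_one' (A := A)
  conv_lhs at h => rw [← 𝟙.eq]
  conv_rhs at h => enter [1]; rw [← 𝟙.eq]
  simpa [TensorProduct.tmul_sum, Finset.sum_mul] using h

lemma sum_tmul_comul_one : ∑ i ∈ 𝟙.index, 𝟙.left i ⊗ₜ[ℂ] Δ (𝟙.right i) =
    ∑ i ∈ 𝟙.index, 𝟙.left i ⊗ₜ[ℂ] ((𝟙.right i ⊗ₜ 1) * Δ (1 : A)) := by
  have h := Coalgebra.coassoc_apply (R := ℂ) (1 : A)
  rw [WeakHopfAlgebra.comul_comul_one] at h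
  conv_lhs at h => enter [2, 1]; rw [← 𝟙.eq]
  conv_rhs at h => rw [← 𝟙.eq]
  simpa [TensorProduct.sum_tmul, Finset.sum_mul, assoc_tmul_one_mul] using h.symm

lemma sum_tmul_comul_one' : ∑ i ∈ 𝟙.index, 𝟙.left i ⊗ₜ[ℂ] Δ (𝟙.right i) =
    ∑ i ∈ 𝟙.index, 𝟙.left i ⊗ₜ[ℂ] (Δ (1 : A) * (𝟙.right i ⊗ₜ 1)) := by
  have h := Coalgebra.coassoc_apply (R := ℂ) (1 : A)
  rw [WeakHopfAlgebra.comul_comul_one'] at h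
  conv_lhs at h => enter [2, 2]; rw [← 𝟙.eq]
  conv_rhs at h => rw [← 𝟙.eq]
  simpa [TensorProduct.sum_tmul, Finset.mul_sum, assoc_mul_tmul_one] using h.symm

lemma comul_piL (x : A) : Δ (piL A x) = (piL A x ⊗ₜ 1) * Δ (1 : A) := by
  have h := congrArg (TensorProduct.lid ℂ _ ∘ LinearMap.rTensor (A ⊗[ℂ] A)
    (ε ∘ₗ LinearMap.mulRight ℂ x)) (sum_tmul_comul_one (A := A))
  simpa [piL_apply, TensorProduct.sum_tmul, Finset.sum_mul, ← TensorProduct.smul_tmul'] using h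

lemma comul_piL' (x : A) : Δ (piL A x) = Δ (1 : A) * (piL A x ⊗ₜ 1) := by
  have h := congrArg (TensorProduct.lid ℂ _ ∘ LinearMap.rTensor (A ⊗[ℂ] A)
    (ε ∘ₗ LinearMap.mulRight ℂ x)) (sum_tmul_comul_one' (A := A))
  simpa [piL_apply, TensorProduct.sum_tmul, Finset.mul_sum, ← TensorProduct.smul_tmul'] using h

lemma comul_piR (x : A) : Δ (piR A x) = Δ (1 : A) * (1 ⊗ₜ piR A x) := by
  have h := congrArg (TensorProduct.rid ℂ _ ∘ LinearMap.lTensor (A ⊗[ℂ] A)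
    (ε ∘ₗ LinearMap.mulLeft ℂ x)) (sum_comul_tmul_one (A := A))
  simpa [piR_apply, TensorProduct.tmul_sum, Finset.mul_sum] using h

lemma comul_piR' (x : A) : Δ (piR A x) = (1 ⊗ₜ piR A x) * Δ (1 : A) := by
  have h := congrArg (TensorProduct.rid ℂ _ ∘ LinearMap.lTensor (A ⊗[ℂ] A)
    (ε ∘ₗ LinearMap.mulLeft ℂ x)) (sum_comul_tmul_one' (A := A))
  simpa [piR_apply, TensorProduct.tmul_sum, Finset.sum_mul] using h

lemma commute_piL_piR (x y : A) : Commute (piL A x) (piR A y) := by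
  have h := congrArg (TensorProduct.rid ℂ _ ∘ TensorProduct.map
    ((TensorProduct.lid ℂ _).toLinearMap ∘ₗ LinearMap.rTensor A (ε ∘ₗ LinearMap.mulRight ℂ x))
    (ε ∘ₗ LinearMap.mulLeft ℂ y))
    ((WeakHopfAlgebra.comul_comul_one (A := A)).symm.trans WeakHopfAlgebra.comul_comul_one')
  simp only [← 𝟙.eq] at h
  simpa [Commute, SemiconjBy, piL_apply, piR_apply, TensorProduct.sum_tmul, TensorProduct.tmul_sum,
    Finset.mul_sum, Finset.sum_mul, Finset.smul_sum, smul_smul, mul_comm] using h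

lemma lTensor_piL_comul (x : A) : LinearMap.lTensor A (piL A) (Δ x) = Δ (1 : A) * (x ⊗ₜ 1) := by
  have h := congrArg (LinearMap.rTensor A ((TensorProduct.rid ℂ A).toLinearMap ∘ₗ
    LinearMap.lTensor A ε ∘ₗ LinearMap.mulRight ℂ (Δ x))) (sum_comul_tmul_one' (A := A))
  simp only [map_sum, LinearMap.rTensor_tmul, LinearMap.comp_apply, LinearMap.mulRight_apply,
    LinearEquiv.coe_coe, ← comul_mul, mul_assoc, one_mul, lTensor_counit_comul,
    TensorProduct.rid_tmul, one_smul] at h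
  rw [comul_one_mul_tmul]
  simp only [mul_one]
  rw [h, ← (ℛ ℂ x).eq]
  simp only [map_sum, LinearMap.lTensor_tmul, piL_apply, TensorProduct.tmul_sum]
  rw [Finset.sum_comm]
  simp [Finset.mul_sum, TensorProduct.sum_tmul, TensorProduct.smul_tmul]

lemma rTensor_piR_comul (x : A) : LinearMap.rTensor A (piR A) (Δ x) = (1 ⊗ₜ x) * Δ (1 : A) := by
  have h := congrArg (LinearMap.lTensor A ((TensorProduct.lid ℂ A).toLinearMap ∘ₗ
    LinearMap.rTensor A ε ∘ₗ LinearMap.mulLeft ℂ (Δ x))) (sum_tmul_comul_one' (A := A))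
  simp only [map_sum, LinearMap.lTensor_tmul, LinearMap.comp_apply, LinearMap.mulLeft_apply,
    LinearEquiv.coe_coe, ← comul_mul, ← mul_assoc, mul_one, rTensor_counit_comul,
    TensorProduct.lid_tmul, one_smul] at h
  rw [tmul_mul_comul_one]
  simp only [one_mul]
  rw [h, ← (ℛ ℂ x).eq]
  simp only [map_sum, LinearMap.rTensor_tmul, piR_apply, TensorProduct.sum_tmul]
  rw [Finset.sum_comm]
  simp [Finset.sum_mul, TensorProduct.tmul_sum, TensorProduct.smul_tmul]

lemma rTensor_piRbar_comul (x : A) :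
    LinearMap.rTensor A piRbar (Δ x) = Δ (1 : A) * (1 ⊗ₜ x) := by
  have h := congrArg (LinearMap.lTensor A ((TensorProduct.lid ℂ A).toLinearMap ∘ₗ
    LinearMap.rTensor A ε ∘ₗ LinearMap.mulRight ℂ (Δ x))) (sum_tmul_comul_one (A := A))
  simp only [map_sum, LinearMap.lTensor_tmul, LinearMap.comp_apply, LinearMap.mulRight_apply,
    LinearEquiv.coe_coe, ← comul_mul, mul_assoc, one_mul, rTensor_counit_comul,
    TensorProduct.lid_tmul, one_smul] at h
  rw [comul_one_mul_tmul]
  simp only [mul_one]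
  rw [h, ← (ℛ ℂ x).eq]
  simp only [map_sum, LinearMap.rTensor_tmul, piRbar_apply, TensorProduct.sum_tmul]
  rw [Finset.sum_comm]
  simp [Finset.mul_sum, TensorProduct.tmul_sum, TensorProduct.smul_tmul]

lemma lTensor_piLbar_comul (x : A) :
    LinearMap.lTensor A piLbar (Δ x) = (x ⊗ₜ 1) * Δ (1 : A) := by
  have h := congrArg (LinearMap.rTensor A ((TensorProduct.rid ℂ A).toLinearMap ∘ₗ
    LinearMap.lTensor A ε ∘ₗ LinearMap.mulLeft ℂ (Δ x))) (sum_comul_tmul_one (A := A))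
  simp only [map_sum, LinearMap.rTensor_tmul, LinearMap.comp_apply, LinearMap.mulLeft_apply,
    LinearEquiv.coe_coe, ← comul_mul, ← mul_assoc, mul_one, lTensor_counit_comul,
    TensorProduct.rid_tmul, one_smul] at h
  rw [tmul_mul_comul_one]
  simp only [one_mul]
  rw [h, ← (ℛ ℂ x).eq]
  simp only [map_sum, LinearMap.lTensor_tmul, piLbar_apply, TensorProduct.tmul_sum]
  rw [Finset.sum_comm]
  simp [Finset.sum_mul, TensorProduct.sum_tmul, TensorProduct.smul_tmul]

lemma rTensor_piR_comul_one : LinearMap.rTensor A (piR A) (Δ (1 : A)) = Δ 1 := by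
  rw [rTensor_piR_comul, ← Algebra.TensorProduct.one_def, one_mul]

lemma lTensor_piL_comul_one : LinearMap.lTensor A (piL A) (Δ (1 : A)) = Δ 1 := by
  rw [lTensor_piL_comul, ← Algebra.TensorProduct.one_def, mul_one]

lemma counit_mul_piL (x y : A) : ε (x * piL A y) = ε (x * y) := by
  have h := WeakHopfAlgebra.counit_mul_mul' x 1 y
  rw [mul_one, ← 𝟙.eq] at h
  simp [h, piL_apply, Finset.mul_sum]

lemma counit_piR_mul (x y : A) : ε (piR A x * y) = ε (x * y) := by
  have h := WeakHopfAlgebra.counit_mul_mul' x 1 y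
  rw [mul_one, ← 𝟙.eq] at h
  simp [h, piR_apply, Finset.sum_mul, mul_comm]

lemma counit_piL (x : A) : ε (piL A x) = ε x := by simpa using counit_mul_piL 1 x

lemma counit_piR (x : A) : ε (piR A x) = ε x := by simpa using counit_piR_mul x 1

lemma piL_mul_piL (x y : A) : piL A (x * piL A y) = piL A (x * y) := by
  simp only [piL_apply (x * _), ← mul_assoc, counit_mul_piL]

lemma piR_piR_mul (x y : A) : piR A (piR A x * y) = piR A (x * y) := by
  simp only [piR_apply (_ * y), mul_assoc, counit_piR_mul]

lemma piL_piL (x : A) : piL A (piL A x) = piL A x := by simpa using piL_mul_piL 1 x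

lemma piR_piR (x : A) : piR A (piR A x) = piR A x := by simpa using piR_piR_mul x 1

lemma sum_counit_mul_counit (x y : A) :
    ∑ i ∈ 𝟙.index, ε (x * 𝟙.left i) * ε (𝟙.right i * y) = ε (x * y) := by
  have h := WeakHopfAlgebra.counit_mul_mul x 1 y
  rw [mul_one, ← 𝟙.eq] at h
  simpa using h.symm

/-! ### The antipode -/

lemma conv_id_antipode : .id ⋆ antipode = piL A := LinearMap.ext WeakHopfAlgebra.mul_antipode

lemma conv_antipode_id : antipode ⋆ .id = piR A := LinearMap.ext WeakHopfAlgebra.antipode_mul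

lemma conv_piR_antipode : piR A ⋆ antipode = antipode := by
  rw [← conv_antipode_id]
  exact LinearMap.ext WeakHopfAlgebra.antipode_mul_antipode

lemma conv_antipode_piL : antipode ⋆ piL A = antipode := by
  rw [← conv_id_antipode, ← conv_assoc, conv_antipode_id, conv_piR_antipode]

lemma conv_mulRight_piL_antipode (x y : A) :
    (LinearMap.mulRight ℂ (piL A y) ⋆ antipode) x = piL A (x * y) := by
  have h : Δ (x * piL A y) = Δ x * (piL A y ⊗ₜ 1) := by
    rw [comul_mul, comul_piL', ← mul_assoc, comul_mul_comul_one]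
  have h' := conv_apply_of_comul_eq h .id antipode
  rw [conv_id_antipode, piL_mul_piL] at h'
  rw [h', conv_apply, ← (ℛ ℂ x).eq]
  simp [Finset.sum_mul]

lemma conv_antipode_mulLeft_piR (x y : A) :
    (antipode ⋆ LinearMap.mulLeft ℂ (piR A x)) y = piR A (x * y) := by
  have h : Δ (piR A x * y) = (1 ⊗ₜ piR A x) * Δ y := by
    rw [comul_mul, comul_piR', mul_assoc, comul_one_mul_comul]
  have h' := conv_apply_of_comul_eq h antipode .id
  rw [conv_antipode_id, piR_piR_mul] at h'
  rw [h', conv_apply, ← (ℛ ℂ y).eq]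
  simp [Finset.mul_sum]

lemma conv_antipode_conv_mulRight_piL_antipode (x l : A) :
    (antipode ⋆ (LinearMap.mulRight ℂ (piL A l) ⋆ antipode)) x = piL A l * antipode x := by
  have h : antipode ⋆ LinearMap.mulRight ℂ (piL A l) = LinearMap.mulLeft ℂ (piL A l) ∘ₗ piR A := by
    have := conv_mulRight_comp (piL A l) (antipode (A := A)) .id
    rw [LinearMap.comp_id, conv_antipode_id] at this
    rw [this]
    ext z
    simp [(commute_piL_piR l z).eq]
  rw [← conv_assoc, h, mulLeft_comp_conv, conv_piR_antipode]
  rfl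

lemma conv_comp_mul' (f g : A →ₗ[ℂ] A) :
    (f ∘ₗ LinearMap.mul' ℂ A) ⋆ (g ∘ₗ LinearMap.mul' ℂ A) = (f ⋆ g) ∘ₗ LinearMap.mul' ℂ A := by
  ext x y
  simp only [TensorProduct.AlgebraTensorModule.curry_apply, LinearMap.restrictScalars_self,
    TensorProduct.curry_apply, conv_tmul, LinearMap.comp_apply, LinearMap.mul'_apply]
  rw [conv_apply_of_comul_eq (comul_mul x y)]
  conv_rhs => rw [← (ℛ ℂ x).eq, ← (ℛ ℂ y).eq]
  simp [Finset.sum_mul_sum]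

/-- The map `x ⊗ y ↦ S(y) S(x)`. Like `S ∘ mul`, it is a convolution generalized inverse of the
multiplication of `A`, and the two are compared to show that `S` is antimultiplicative. -/
def antipodeMulRev : A ⊗[ℂ] A →ₗ[ℂ] A :=
  LinearMap.mul' ℂ A ∘ₗ TensorProduct.map antipode antipode ∘ₗ
    (TensorProduct.comm ℂ A A).toLinearMap

lemma antipodeMulRev_tmul (x y : A) : antipodeMulRev (x ⊗ₜ y) = antipode y * antipode x := by
  simp [antipodeMulRev]

lemma conv_mul'_antipodeMulRev_tmul (x y : A) :
    (LinearMap.mul' ℂ A ⋆ antipodeMulRev) (x ⊗ₜ y) =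
      (LinearMap.mulRight ℂ (piL A y) ⋆ antipode) x := by
  rw [← conv_id_antipode, conv_apply _ antipode x, conv_tmul]
  simp [antipodeMulRev_tmul, conv_apply, Finset.mul_sum, Finset.sum_mul, mul_assoc]

lemma conv_mul'_antipodeMulRev :
    LinearMap.mul' ℂ A ⋆ antipodeMulRev = piL A ∘ₗ LinearMap.mul' ℂ A := by
  ext x y
  simpa using (conv_mul'_antipodeMulRev_tmul x y).trans (conv_mulRight_piL_antipode x y)

lemma conv_antipodeMulRev_mul' :
    antipodeMulRev ⋆ LinearMap.mul' ℂ A = piR A ∘ₗ LinearMap.mul' ℂ A := by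
  ext x y
  have h : (antipodeMulRev ⋆ LinearMap.mul' ℂ A) (x ⊗ₜ y) =
      (antipode ⋆ LinearMap.mulLeft ℂ (piR A x)) y := by
    rw [← conv_antipode_id, conv_apply antipode _ y, conv_tmul, Finset.sum_comm]
    simp [antipodeMulRev_tmul, conv_apply, Finset.mul_sum, Finset.sum_mul, mul_assoc]
  simpa using h.trans (conv_antipode_mulLeft_piR x y)

lemma conv_antipodeMulRev_mul'_antipodeMulRev :
    antipodeMulRev ⋆ LinearMap.mul' ℂ A ⋆ antipodeMulRev = antipodeMulRev (A := A) := by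
  rw [conv_assoc]
  ext x y
  have h : (antipodeMulRev ⋆ (LinearMap.mul' ℂ A ⋆ antipodeMulRev)) (x ⊗ₜ[ℂ] y) =
      ∑ j ∈ (ℛ ℂ y).index, antipode ((ℛ ℂ y).left j) *
        (antipode ⋆ (LinearMap.mulRight ℂ (piL A ((ℛ ℂ y).right j)) ⋆ antipode)) x := by
    rw [conv_tmul, Finset.sum_comm]
    simp only [conv_mul'_antipodeMulRev_tmul, conv_apply antipode (_ ⋆ _) x, antipodeMulRev_tmul,
      Finset.mul_sum, mul_assoc]
  simp only [TensorProduct.AlgebraTensorModule.curry_apply, LinearMap.restrictScalars_self,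
    TensorProduct.curry_apply, h, conv_antipode_conv_mulRight_piL_antipode, antipodeMulRev_tmul]
  conv_rhs => rw [← conv_antipode_piL, conv_apply]
  simp [Finset.sum_mul, mul_assoc, conv_antipode_piL]

theorem antipode_mul_antidistrib (x y : A) : antipode (x * y) = antipode y * antipode x := by
  have hl : (antipode ∘ₗ LinearMap.mul' ℂ A) ⋆ LinearMap.mul' ℂ A =
      piR A ∘ₗ LinearMap.mul' ℂ A := by
    rw [← conv_antipode_id, ← conv_comp_mul', LinearMap.id_comp]
  have hr : LinearMap.mul' ℂ A ⋆ (antipode ∘ₗ LinearMap.mul' ℂ A) =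
      piL A ∘ₗ LinearMap.mul' ℂ A := by
    rw [← conv_id_antipode, ← conv_comp_mul', LinearMap.id_comp]
  have h := eq_of_conv_eq (by rw [hl, conv_comp_mul', conv_piR_antipode])
    conv_antipodeMulRev_mul'_antipodeMulRev (hl.trans conv_antipodeMulRev_mul'.symm)
    (hr.trans conv_mul'_antipodeMulRev.symm)
  simpa [antipodeMulRev_tmul] using LinearMap.congr_fun h (x ⊗ₜ y)

lemma antipode_piR (x : A) : antipode (piR A x) = piL A (piR A x) := by
  have h : (.id ⋆ antipode) (1 : A) * antipode (piR A x) = antipode (piR A x) := by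
    rw [conv_id_antipode, piL_one, one_mul]
  rw [← conv_id_antipode, conv_apply_of_comul_eq (comul_piR' x), ← h, conv_apply, ← 𝟙.eq]
  simp [Finset.mul_sum, Finset.sum_mul, antipode_mul_antidistrib, mul_assoc]

lemma antipode_piL (x : A) : antipode (piL A x) = piR A (piL A x) := by
  have h : antipode (piL A x) * (antipode ⋆ .id) (1 : A) = antipode (piL A x) := by
    rw [conv_antipode_id, piR_one, mul_one]
  rw [← conv_antipode_id, conv_apply_of_comul_eq (comul_piL' x), ← h, conv_apply, ← 𝟙.eq]
  simp [Finset.mul_sum, Finset.sum_mul, antipode_mul_antidistrib, mul_assoc]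

lemma antipode_one : antipode (1 : A) = 1 := by
  have h := antipode_piR (1 : A)
  rwa [piR_one, piL_one] at h

lemma rTensor_antipode_comul_one :
    LinearMap.rTensor A antipode (Δ (1 : A)) = LinearMap.rTensor A (piL A) (Δ 1) := by
  rw [← rTensor_piR_comul_one, ← LinearMap.rTensor_comp_apply, ← LinearMap.rTensor_comp_apply,
    show antipode ∘ₗ piR A = piL A ∘ₗ piR A from LinearMap.ext antipode_piR]

lemma lTensor_antipode_comul_one :
    LinearMap.lTensor A antipode (Δ (1 : A)) = LinearMap.lTensor A (piR A) (Δ 1) := by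
  rw [← lTensor_piL_comul_one, ← LinearMap.lTensor_comp_apply, ← LinearMap.lTensor_comp_apply,
    show antipode ∘ₗ piL A = piR A ∘ₗ piL A from LinearMap.ext antipode_piL]

lemma antipode_piRbar (x : A) : antipode (piRbar x) = piL A x := by
  have h := congrArg (TensorProduct.rid ℂ A ∘ LinearMap.lTensor A (ε ∘ₗ LinearMap.mulRight ℂ x))
    (rTensor_antipode_comul_one (A := A))
  rw [← 𝟙.eq] at h
  simp only [Function.comp_apply, map_sum, LinearMap.rTensor_tmul, LinearMap.lTensor_tmul,
    TensorProduct.rid_tmul, LinearMap.comp_apply, LinearMap.mulRight_apply] at h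
  simp only [piRbar_apply, map_sum, map_smul, h, piL_apply, Finset.smul_sum, smul_smul]
  rw [Finset.sum_comm]
  refine Finset.sum_congr rfl fun i _ => ?_
  simp only [← sum_counit_mul_counit (𝟙.left i) x, Finset.sum_smul, mul_comm]

lemma antipode_piLbar (x : A) : antipode (piLbar x) = piR A x := by
  have h := congrArg (TensorProduct.lid ℂ A ∘ LinearMap.rTensor A (ε ∘ₗ LinearMap.mulLeft ℂ x))
    (lTensor_antipode_comul_one (A := A))
  rw [← 𝟙.eq] at h
  simp only [Function.comp_apply, map_sum, LinearMap.rTensor_tmul, LinearMap.lTensor_tmul,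
    TensorProduct.lid_tmul, LinearMap.comp_apply, LinearMap.mulLeft_apply] at h
  simp only [piLbar_apply, map_sum, map_smul, h, piR_apply, Finset.smul_sum, smul_smul]
  rw [Finset.sum_comm]
  refine Finset.sum_congr rfl fun i _ => ?_
  simp only [← sum_counit_mul_counit x (𝟙.right i), Finset.sum_smul]

lemma rTensor_piL_comul (x : A) : LinearMap.rTensor A (piL A) (Δ x) =
    LinearMap.rTensor A antipode (Δ (1 : A) * (1 ⊗ₜ x)) := by
  rw [← rTensor_piRbar_comul, ← LinearMap.rTensor_comp_apply,
    show antipode ∘ₗ piRbar = piL A from LinearMap.ext antipode_piRbar]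

lemma map_antipode_comul_one : TensorProduct.map antipode antipode (Δ (1 : A)) =
    TensorProduct.comm ℂ A A (Δ 1) := by
  have h1 : TensorProduct.map antipode antipode (Δ (1 : A)) =
      TensorProduct.map (piL A) (piR A) (Δ 1) := by
    rw [← LinearMap.rTensor_comp_lTensor, LinearMap.comp_apply, lTensor_antipode_comul_one,
      ← LinearMap.comp_apply, LinearMap.rTensor_comp_lTensor, ← LinearMap.lTensor_comp_rTensor,
      LinearMap.comp_apply, rTensor_antipode_comul_one, ← LinearMap.comp_apply,
      LinearMap.lTensor_comp_rTensor]
  have h2 (i) : piL A (𝟙.left i) ⊗ₜ[ℂ] piR A (𝟙.right i) = ∑ k ∈ 𝟙.index, ∑ j ∈ 𝟙.index,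
      (ε (𝟙.left j * 𝟙.left i) * ε (𝟙.right i * 𝟙.right k)) • (𝟙.right j ⊗ₜ[ℂ] 𝟙.left k) := by
    simp only [piL_apply, piR_apply, TensorProduct.sum_tmul, TensorProduct.tmul_sum,
      TensorProduct.smul_tmul_smul]
  rw [h1]
  conv_rhs => rw [← lTensor_piL_comul_one]
  rw [← 𝟙.eq]
  simp only [map_sum, TensorProduct.map_tmul, LinearMap.lTensor_tmul, TensorProduct.comm_tmul, h2]
  rw [Finset.sum_comm]
  refine Finset.sum_congr rfl fun k _ => ?_
  rw [Finset.sum_comm, piL_apply, TensorProduct.sum_tmul]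
  refine Finset.sum_congr rfl fun j _ => ?_
  rw [← Finset.sum_smul, sum_counit_mul_counit, TensorProduct.smul_tmul']

lemma map_antipode_mul (s t : A ⊗[ℂ] A) : TensorProduct.map antipode antipode (s * t) =
    TensorProduct.map antipode antipode t * TensorProduct.map antipode antipode s := by
  induction s with
  | zero => simp
  | add a b ha hb => simp only [add_mul, mul_add, map_add, ha, hb]
  | tmul a b =>
    induction t with
    | zero => simp
    | add c d hc hd => simp only [add_mul, mul_add, map_add, hc, hd]
    | tmul c d => simp [antipode_mul_antidistrib]

lemma conv_comul_comp (f g : A →ₗ[ℂ] A) : (Δ ∘ₗ f) ⋆ (Δ ∘ₗ g) = Δ ∘ₗ (f ⋆ g) := by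
  ext x; simp [conv_apply, comul_mul]

local notation "ι₁" => AlgHom.toLinearMap (Algebra.TensorProduct.includeLeft : A →ₐ[ℂ] A ⊗[ℂ] A)
local notation "ι₂" => AlgHom.toLinearMap (Algebra.TensorProduct.includeRight : A →ₐ[ℂ] A ⊗[ℂ] A)

lemma conv_inl_inr_comp_piL : ι₁ ⋆ (ι₂ ∘ₗ piL A) = LinearMap.mulLeft ℂ (Δ (1 : A)) ∘ₗ ι₁ := by
  rw [← LinearMap.comp_id ι₁, conv_includeLeft_includeRight]
  ext x
  simpa [LinearMap.lTensor] using lTensor_piL_comul x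

lemma conv_inl_comp_piR_inr : (ι₁ ∘ₗ piR A) ⋆ ι₂ = LinearMap.mulRight ℂ (Δ (1 : A)) ∘ₗ ι₂ := by
  rw [← LinearMap.comp_id ι₂, conv_includeLeft_includeRight]
  ext x
  simpa [LinearMap.rTensor] using rTensor_piR_comul x

/-- The map `x ↦ S(x₍₂₎) ⊗ S(x₍₁₎)`. Like `Δ ∘ S`, it is a convolution generalized inverse of the
coproduct of `A`, and the two are compared to show that `S` is anticomultiplicative. -/
def antipodeComulRev : A →ₗ[ℂ] A ⊗[ℂ] A := (ι₂ ∘ₗ antipode) ⋆ (ι₁ ∘ₗ antipode)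

lemma antipodeComulRev_apply (x : A) : antipodeComulRev x =
    TensorProduct.comm ℂ A A (TensorProduct.map antipode antipode (Δ x)) := by
  rw [← (ℛ ℂ x).eq]
  simp [antipodeComulRev, conv_apply]

lemma comul_one_mul_antipodeComulRev (x : A) :
    Δ (1 : A) * antipodeComulRev x = antipodeComulRev x := by
  have h : Δ (1 : A) = Algebra.TensorProduct.comm ℂ A A
      (TensorProduct.map antipode antipode (Δ (1 : A))) := by
    rw [map_antipode_comul_one]
    exact (TensorProduct.comm_comm ..).symm
  have hx : antipodeComulRev x = Algebra.TensorProduct.comm ℂ A A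
    (TensorProduct.map antipode antipode (Δ x)) := antipodeComulRev_apply x
  rw [hx, h, ← map_mul, ← map_antipode_mul, comul_mul_comul_one]

lemma conv_comul_antipodeComulRev : Δ ⋆ antipodeComulRev = Δ ∘ₗ piL A := by
  have h₁ : ι₁ ⋆ (ι₁ ∘ₗ antipode) = ι₁ ∘ₗ piL A := by
    rw [← conv_id_antipode, algHom_comp_conv, LinearMap.comp_id]
  have h₂ : ι₂ ⋆ (ι₂ ∘ₗ antipode) = ι₂ ∘ₗ piL A := by
    rw [← conv_id_antipode, algHom_comp_conv, LinearMap.comp_id]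
  rw [← conv_includeLeft_includeRight_eq_comul, antipodeComulRev, conv_assoc,
    ← conv_assoc ι₂, h₂, ← conv_assoc,
    conv_inl_inr_comp_piL, mulLeft_comp_conv, h₁, conv_includeLeft_includeRight_eq_comul]
  ext x
  simp [comul_piL']

lemma conv_antipodeComulRev_comul :
    antipodeComulRev ⋆ Δ = LinearMap.mulRight ℂ (Δ (1 : A)) ∘ₗ ι₂ ∘ₗ piR A := by
  have h₁ : (ι₁ ∘ₗ antipode) ⋆ ι₁ = ι₁ ∘ₗ piR A := by
    rw [← conv_antipode_id, algHom_comp_conv, LinearMap.comp_id]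
  have h₂ : (ι₂ ∘ₗ antipode) ⋆ ι₂ = ι₂ ∘ₗ piR A := by
    rw [← conv_antipode_id, algHom_comp_conv, LinearMap.comp_id]
  rw [← conv_includeLeft_includeRight_eq_comul, antipodeComulRev, conv_assoc,
    ← conv_assoc (ι₁ ∘ₗ antipode), h₁,
    conv_inl_comp_piR_inr, conv_mulRight_comp, h₂, conv_includeLeft_includeRight_eq_comul]

lemma conv_antipodeComulRev_comul_antipodeComulRev :
    antipodeComulRev ⋆ Δ ⋆ antipodeComulRev = antipodeComulRev (A := A) := by
  have h₁ : LinearMap.mulLeft ℂ (Δ (1 : A)) ∘ₗ antipodeComulRev = antipodeComulRev :=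
    LinearMap.ext comul_one_mul_antipodeComulRev
  have h₂ : (ι₂ ∘ₗ piR A) ⋆ (ι₂ ∘ₗ antipode) = ι₂ ∘ₗ antipode := by
    rw [← algHom_comp_conv, conv_piR_antipode]
  rw [conv_antipodeComulRev_comul, mulRight_comp_conv, h₁, antipodeComulRev, ← conv_assoc, h₂]

theorem comul_antipode (x : A) : Δ (antipode x) =
    TensorProduct.comm ℂ A A (TensorProduct.map antipode antipode (Δ x)) := by
  have hl : (Δ ∘ₗ antipode) ⋆ Δ = Δ ∘ₗ piR A := by
    simpa [conv_antipode_id] using conv_comul_comp (A := A) antipode .id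
  have hr : Δ ⋆ (Δ ∘ₗ antipode) = Δ ∘ₗ piL A := by
    simpa [conv_id_antipode] using conv_comul_comp (A := A) .id antipode
  have hl' : antipodeComulRev ⋆ Δ = Δ ∘ₗ piR A := by
    rw [conv_antipodeComulRev_comul]; ext x; simp [comul_piR']
  have h := eq_of_conv_eq (by rw [hl, conv_comul_comp, conv_piR_antipode])
    conv_antipodeComulRev_comul_antipodeComulRev (hl.trans hl'.symm)
    (hr.trans conv_comul_antipodeComulRev.symm)
  rw [← antipodeComulRev_apply, ← h, LinearMap.comp_apply]

end WeakHopf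

section Slices

variable {A : Type*} [Ring A] [Algebra ℂ A] [Coalgebra ℂ A]

/-! ### Slices of the coproduct -/

lemma haarEL_apply {ι : Type*} {x : A} (r : Coalgebra.Repr ℂ x ι) (φ : Module.Dual ℂ A) :
    haarEL φ x = ∑ i ∈ r.index, φ (r.right i) • r.left i := by
  simp [haarEL, ← r.eq]

lemma haarER_apply {ι : Type*} {x : A} (r : Coalgebra.Repr ℂ x ι) (φ : Module.Dual ℂ A) :
    haarER φ x = ∑ i ∈ r.index, φ (r.left i) • r.right i := by
  simp [haarER, ← r.eq]

lemma haarEL_counit (x : A) : haarEL ε x = x := by simp [haarEL]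

lemma haarER_counit (x : A) : haarER ε x = x := by simp [haarER]

lemma dualMul_apply_eq_haarEL (φ ψ : Module.Dual ℂ A) (x : A) :
    dualMul φ ψ x = φ (haarEL ψ x) := by
  simp [haarEL_apply (ℛ ℂ x), dualMul, ← (ℛ ℂ x).eq, mul_comm]

lemma dualMul_apply_eq_haarER (φ ψ : Module.Dual ℂ A) (x : A) :
    dualMul φ ψ x = ψ (haarER φ x) := by
  simp [haarER_apply (ℛ ℂ x), dualMul, ← (ℛ ℂ x).eq]

lemma counit_dualMul (φ : Module.Dual ℂ A) : dualMul ε φ = φ := by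
  ext x; rw [dualMul_apply_eq_haarER, haarER_counit]

lemma dualMul_counit (φ : Module.Dual ℂ A) : dualMul φ ε = φ := by
  ext x; rw [dualMul_apply_eq_haarEL, haarEL_counit]

lemma apply_haarEL (φ ψ : Module.Dual ℂ A) (x : A) : φ (haarEL ψ x) = ψ (haarER φ x) := by
  rw [← dualMul_apply_eq_haarEL, dualMul_apply_eq_haarER]

lemma counit_haarEL (φ : Module.Dual ℂ A) (x : A) : ε (haarEL φ x) = φ x := by
  rw [apply_haarEL, haarER_counit]

/-- The decomposition `Δ(x) = ∑ bₐ ⊗ xₐ` along a basis `b` of `A`. -/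
def reprOfBasis {ι : Type*} [Fintype ι] (b : Module.Basis ι ℂ A) (x : A) :
    Coalgebra.Repr ℂ x ι where
  index := Finset.univ
  left := b
  right a := haarER (b.coord a) x
  eq := by
    classical
    have h := TensorProduct.equivFinsuppOfBasisLeft_symm_apply b
      (TensorProduct.equivFinsuppOfBasisLeft b (Δ x))
    rw [LinearEquiv.symm_apply_apply, Finsupp.sum_fintype _ _ fun _ => TensorProduct.tmul_zero _ _]
      at h
    simp only [TensorProduct.equivFinsuppOfBasisLeft_apply] at h
    exact h.symm

lemma IsHaarFunctional.unique {h h' : Module.Dual ℂ A} (H : IsHaarFunctional h)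
    (H' : IsHaarFunctional h') : h = h' := by
  rw [← counit_dualMul h, ← H'.left_normalized, ← H.left_integral, H'.right_integral,
    H.right_normalized, dualMul_counit]

end Slices

section RegularTrace

/-! ### The regular trace -/

/-- The character of the left regular representation of `A`. Mathlib's `Algebra.trace` is restricted
to commutative algebras. -/
def regTrace (R : Type*) {A : Type*} [CommRing R] [Ring A] [Algebra R A] : A →ₗ[R] R :=
  LinearMap.trace R A ∘ₗ LinearMap.mul R A

section CommRing

variable {R A : Type*} [CommRing R] [Ring A] [Algebra R A]

lemma regTrace_apply (x : A) :
    regTrace R x = LinearMap.trace R A (LinearMap.mulLeft R x) := rfl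

lemma regTrace_mul_comm (x y : A) : regTrace R (x * y) = regTrace R (y * x) := by
  rw [regTrace_apply, regTrace_apply, LinearMap.mulLeft_mul, LinearMap.mulLeft_mul]
  exact LinearMap.trace_mul_comm R _ _

end CommRing

variable {K A : Type*} [Field K] [Ring A] [Algebra K A] [FiniteDimensional K A] {t : A →ₗ[K] K}

lemma exists_dual_bases (ht : ∀ x, (∀ y, t (x * y) = 0) → x = 0) :
    ∃ (n : ℕ) (a b : Fin n → A), (∀ x, ∑ i, t (b i * x) • a i = x) ∧
      (∀ x, ∑ i, t (x * a i) • b i = x) ∧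
      ∀ f : A →ₗ[K] A, LinearMap.trace K A f = ∑ i, t (b i * f (a i)) := by
  let B : A →ₗ[K] Module.Dual K A := LinearMap.compr₂ (LinearMap.mul K A) t
  have hinj : Function.Injective B :=
    (injective_iff_map_eq_zero B).2 fun x hx => ht x fun y => LinearMap.congr_fun hx y
  have hsurj : Function.Surjective B :=
    (LinearMap.injective_iff_surjective_of_finrank_eq_finrank
      (Subspace.dual_finrank_eq (K := K) (V := A)).symm).1 hinj
  let e := Module.finBasis K A
  choose b hb using fun i => hsurj (e.coord i)
  have hb' (i) (x : A) : t (b i * x) = e.repr x i := LinearMap.congr_fun (hb i) x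
  have hexpand (x : A) : ∑ i, t (b i * x) • e i = x := by simp only [hb', e.sum_repr]
  refine ⟨_, e, b, hexpand, fun x => ?_, fun f => ?_⟩
  · refine sub_eq_zero.1 (ht _ fun y => ?_)
    rw [sub_mul, map_sub, sub_eq_zero]
    conv_rhs => rw [← hexpand y]
    simp only [Finset.sum_mul, Finset.mul_sum, smul_mul_assoc, mul_smul_comm, map_sum, map_smul,
      smul_eq_mul, mul_comm]
  · rw [LinearMap.trace_eq_matrix_trace K e, Matrix.trace]
    simp [LinearMap.toMatrix_apply, hb']

lemma trace_mulRight_eq_regTrace (ht : ∀ x, (∀ y, t (x * y) = 0) → x = 0)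
    (htr : ∀ x y, t (x * y) = t (y * x)) (x : A) :
    LinearMap.trace K A (LinearMap.mulRight K x) = regTrace K x := by
  obtain ⟨n, a, b, hexpand, -, htrace⟩ := exists_dual_bases ht
  have casimir_comm : ∑ i, b i * a i = ∑ i, a i * b i := by
    calc ∑ i, b i * a i = ∑ i, (∑ j, t (b j * b i) • a j) * a i := by simp only [hexpand]
      _ = ∑ j, a j * ∑ i, t (b i * b j) • a i := by
        simp only [Finset.sum_mul, Finset.mul_sum]
        rw [Finset.sum_comm]
        refine Finset.sum_congr rfl fun i _ => Finset.sum_congr rfl fun j _ => ?_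
        rw [htr]; simp
      _ = ∑ i, a i * b i := by simp only [hexpand]
  calc LinearMap.trace K A (LinearMap.mulRight K x) = t ((∑ i, b i * a i) * x) := by
        simp [htrace, Finset.sum_mul, mul_assoc]
    _ = ∑ i, t (b i * (x * a i)) := by
        rw [casimir_comm, Finset.sum_mul, map_sum]
        refine Finset.sum_congr rfl fun i _ => ?_
        rw [mul_assoc, htr, mul_assoc]
    _ = regTrace K x := (htrace (LinearMap.mulLeft K x)).symm

end RegularTrace

local notation "χ" => regTrace ℂ

section WeakHopf

/-! ### The subalgebras `A^L` and `A^R` -/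

variable {A : Type*} [Ring A] [Algebra ℂ A] [Coalgebra ℂ A]

local notation "𝟙" => ℛ ℂ (1 : A)

lemma piL_mem (x : A) : piL A x ∈ leftSub A := ⟨x, rfl⟩

lemma piR_mem (x : A) : piR A x ∈ rightSub A := ⟨x, rfl⟩

lemma mem_left_of_comul {x : A} (h : Δ x = Δ 1 * (x ⊗ₜ 1)) : x ∈ leftSub A := by
  refine ⟨x, ?_⟩
  have hx := rTensor_counit_comul (R := ℂ) x
  rw [h, comul_one_mul_tmul] at hx
  simpa [piL_apply] using congrArg (TensorProduct.lid ℂ A) hx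

lemma mem_right_of_comul {x : A} (h : Δ x = (1 ⊗ₜ x) * Δ 1) : x ∈ rightSub A := by
  refine ⟨x, ?_⟩
  have hx := lTensor_counit_comul (R := ℂ) x
  rw [h, tmul_mul_comul_one] at hx
  simpa [piR_apply] using congrArg (TensorProduct.rid ℂ A) hx

lemma one_mem_left : (1 : A) ∈ leftSub A := ⟨1, piL_one⟩

lemma one_mem_right : (1 : A) ∈ rightSub A := ⟨1, piR_one⟩

variable [WeakHopfAlgebra A]

lemma piL_of_mem {x : A} (h : x ∈ leftSub A) : piL A x = x := by
  obtain ⟨y, rfl⟩ := h; exact piL_piL y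

lemma piR_of_mem {x : A} (h : x ∈ rightSub A) : piR A x = x := by
  obtain ⟨y, rfl⟩ := h; exact piR_piR y

lemma comul_of_mem_left {x : A} (h : x ∈ leftSub A) : Δ x = (x ⊗ₜ 1) * Δ 1 := by
  obtain ⟨y, rfl⟩ := h; exact comul_piL y

lemma comul_of_mem_left' {x : A} (h : x ∈ leftSub A) : Δ x = Δ 1 * (x ⊗ₜ 1) := by
  obtain ⟨y, rfl⟩ := h; exact comul_piL' y

lemma comul_of_mem_right {x : A} (h : x ∈ rightSub A) : Δ x = Δ 1 * (1 ⊗ₜ x) := by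
  obtain ⟨y, rfl⟩ := h; exact comul_piR y

lemma comul_of_mem_right' {x : A} (h : x ∈ rightSub A) : Δ x = (1 ⊗ₜ x) * Δ 1 := by
  obtain ⟨y, rfl⟩ := h; exact comul_piR' y

lemma mul_mem_left {x y : A} (hx : x ∈ leftSub A) (hy : y ∈ leftSub A) : x * y ∈ leftSub A := by
  apply mem_left_of_comul
  rw [comul_mul, comul_of_mem_left' hx, comul_of_mem_left' hy, mul_assoc, ← mul_assoc _ (Δ 1),
    ← comul_of_mem_left hx, comul_of_mem_left' hx, ← mul_assoc, ← mul_assoc, ← comul_mul, one_mul,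
    mul_assoc, Algebra.TensorProduct.tmul_mul_tmul, one_mul]

lemma mul_mem_right {x y : A} (hx : x ∈ rightSub A) (hy : y ∈ rightSub A) :
    x * y ∈ rightSub A := by
  apply mem_right_of_comul
  rw [comul_mul, comul_of_mem_right' hx, comul_of_mem_right' hy, mul_assoc, ← mul_assoc (Δ 1),
    ← comul_of_mem_right hy, comul_of_mem_right' hy, mul_assoc, ← comul_mul, one_mul,
    ← mul_assoc, Algebra.TensorProduct.tmul_mul_tmul, one_mul]

lemma antipode_of_mem_left {x : A} (hx : x ∈ leftSub A) : antipode x = piR A x := by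
  rw [← piL_of_mem hx, antipode_piL]

lemma antipode_of_mem_right {x : A} (hx : x ∈ rightSub A) : antipode x = piL A x := by
  rw [← piR_of_mem hx, antipode_piR]

lemma antipode_mem_right {x : A} (hx : x ∈ leftSub A) : antipode x ∈ rightSub A := by
  rw [antipode_of_mem_left hx]; exact piR_mem x

lemma antipode_mem_left {x : A} (hx : x ∈ rightSub A) : antipode x ∈ leftSub A := by
  rw [antipode_of_mem_right hx]; exact piL_mem x

lemma antipode_of_mem {x : A} (hx : x ∈ leftSub A) (hx' : x ∈ rightSub A) : antipode x = x := by
  rw [antipode_of_mem_left hx, piR_of_mem hx']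

lemma dualMul_eq_of_haarEL_mem {h : Module.Dual ℂ A} (H : ∀ x, haarEL h x ∈ leftSub A)
    (φ : Module.Dual ℂ A) : dualMul φ h = dualMul (φ ∘ₗ piL A) h := by
  ext x
  rw [dualMul_apply_eq_haarEL, dualMul_apply_eq_haarEL, LinearMap.comp_apply, piL_of_mem (H x)]

lemma dualMul_eq_of_haarER_mem {h : Module.Dual ℂ A} (H : ∀ x, haarER h x ∈ rightSub A)
    (φ : Module.Dual ℂ A) : dualMul h φ = dualMul h (φ ∘ₗ piR A) := by
  ext x
  rw [dualMul_apply_eq_haarER, dualMul_apply_eq_haarER, LinearMap.comp_apply, piR_of_mem (H x)]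

lemma haarEL_left_mul (φ : Module.Dual ℂ A) {b : A} (hb : b ∈ leftSub A) (x : A) :
    haarEL φ (b * x) = b * haarEL φ x := by
  simp only [haarEL, LinearMap.comp_apply, LinearEquiv.coe_coe]
  rw [comul_mul, comul_of_mem_left hb, mul_assoc, comul_one_mul_comul, ← (ℛ ℂ x).eq]
  simp [Finset.mul_sum]

lemma haarEL_mul_left (φ : Module.Dual ℂ A) {b : A} (hb : b ∈ leftSub A) (x : A) :
    haarEL φ (x * b) = haarEL φ x * b := by
  simp only [haarEL, LinearMap.comp_apply, LinearEquiv.coe_coe]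
  rw [comul_mul, comul_of_mem_left' hb, ← mul_assoc, comul_mul_comul_one, ← (ℛ ℂ x).eq]
  simp [Finset.sum_mul]

lemma haarEL_one_mem_right (φ : Module.Dual ℂ A) : haarEL φ (1 : A) ∈ rightSub A := by
  rw [haarEL, LinearMap.comp_apply, LinearMap.comp_apply, ← rTensor_piR_comul_one, ← 𝟙.eq]
  simp only [map_sum, LinearMap.rTensor_tmul, LinearMap.lTensor_tmul, LinearEquiv.coe_coe,
    TensorProduct.rid_tmul]
  exact Submodule.sum_mem _ fun i _ => Submodule.smul_mem _ _ (piR_mem _)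

lemma haarEL_one_mul (φ : Module.Dual ℂ A) (x : A) :
    haarEL φ 1 * x = haarEL (φ ∘ₗ piL A) x := by
  simp only [haarEL, LinearMap.comp_apply, LinearMap.lTensor_comp_apply, lTensor_piL_comul,
    comul_one_mul_tmul]
  conv_lhs => rw [← 𝟙.eq]
  simp [Finset.sum_mul]

lemma mul_haarEL_one (φ : Module.Dual ℂ A) (x : A) :
    x * haarEL φ 1 = haarEL (φ ∘ₗ piLbar) x := by
  simp only [haarEL, LinearMap.comp_apply, LinearMap.lTensor_comp_apply, lTensor_piLbar_comul,
    tmul_mul_comul_one]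
  conv_lhs => rw [← 𝟙.eq]
  simp [Finset.mul_sum]

lemma haarER_comp_piL (φ : Module.Dual ℂ A) (x : A) :
    haarER (φ ∘ₗ piL A) x = haarER (φ ∘ₗ antipode) 1 * x := by
  simp only [haarER, LinearMap.comp_apply, LinearMap.rTensor_comp_apply, rTensor_piL_comul,
    comul_one_mul_tmul]
  conv_rhs => rw [← 𝟙.eq]
  simp [Finset.sum_mul]

lemma sum_antipode_mul :
    ∑ i ∈ 𝟙.index, antipode (𝟙.left i) * 𝟙.right i = 1 := by
  simpa [conv_antipode_id, piR_one] using (conv_apply (antipode (A := A)) .id 1).symm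

/-! ### The trace formula -/

lemma sum_haarER_coord_haarER {ι : Type*} [Fintype ι] (b : Module.Basis ι ℂ A)
    (φ : Module.Dual ℂ A) (y : A) :
    ∑ a, haarER (b.coord a) (haarER (φ ∘ₗ LinearMap.mulRight ℂ (antipode (b a))) y) =
      haarER (φ ∘ₗ piL A) y := by
  have h := congrArg ((TensorProduct.lid ℂ A).toLinearMap ∘ₗ
    LinearMap.rTensor A (φ ∘ₗ LinearMap.mul' ℂ A ∘ₗ LinearMap.lTensor A antipode) ∘ₗ
    (TensorProduct.assoc ℂ A A A).symm.toLinearMap)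
    (Coalgebra.sum_tmul_tmul_eq (ℛ ℂ y) (fun i => ℛ ℂ ((ℛ ℂ y).left i))
      fun i => reprOfBasis b ((ℛ ℂ y).right i))
  simp only [map_sum, LinearMap.comp_apply, LinearEquiv.coe_coe, TensorProduct.assoc_symm_tmul,
    LinearMap.rTensor_tmul, LinearMap.lTensor_tmul, LinearMap.mul'_apply,
    TensorProduct.lid_tmul] at h
  simp only [haarER_apply (ℛ ℂ y), map_sum, map_smul, LinearMap.comp_apply,
    LinearMap.mulRight_apply]
  rw [Finset.sum_comm]
  refine h.symm.trans (Finset.sum_congr rfl fun i _ => ?_)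
  rw [← conv_id_antipode, conv_apply, map_sum, Finset.sum_smul]
  rfl

section Involutive

variable (hS : Function.Involutive (antipode : A →ₗ[ℂ] A))
include hS

lemma piRbar_eq_sum (x : A) : piRbar x =
    ∑ i ∈ (ℛ ℂ x).index, (ℛ ℂ x).right i * antipode ((ℛ ℂ x).left i) := by
  rw [← hS (piRbar x), antipode_piRbar, ← conv_id_antipode, conv_apply, map_sum]
  simp [antipode_mul_antidistrib, hS _]

lemma piLbar_eq_sum (x : A) : piLbar x =
    ∑ i ∈ (ℛ ℂ x).index, antipode ((ℛ ℂ x).right i) * (ℛ ℂ x).left i := by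
  rw [← hS (piLbar x), antipode_piLbar, ← conv_antipode_id, conv_apply, map_sum]
  simp [antipode_mul_antidistrib, hS _]

lemma sum_mul_antipode :
    ∑ i ∈ 𝟙.index, 𝟙.right i * antipode (𝟙.left i) = 1 := by
  have h := congrArg antipode (conv_apply .id (antipode (A := A)) 1)
  rw [conv_id_antipode, piL_one, antipode_one, map_sum] at h
  simpa [antipode_mul_antidistrib, hS _] using h.symm

lemma comp_piL_eq_comp_piLbar {t : Module.Dual ℂ A} (ht : ∀ x y, t (x * y) = t (y * x)) :
    t ∘ₗ piL A = t ∘ₗ piLbar := by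
  ext x
  rw [LinearMap.comp_apply, LinearMap.comp_apply, piLbar_eq_sum hS, ← conv_id_antipode, conv_apply,
    map_sum, map_sum]
  exact Finset.sum_congr rfl fun i _ => ht _ _

lemma haarEL_one_mul_comm {t : Module.Dual ℂ A} (ht : ∀ x y, t (x * y) = t (y * x)) (x : A) :
    haarEL t 1 * x = x * haarEL t 1 := by
  rw [haarEL_one_mul, mul_haarEL_one, comp_piL_eq_comp_piLbar hS ht]

lemma sum_comul_right_mul_antipode_left {ι : Type*} {x : A} (r : Coalgebra.Repr ℂ x ι) :
    ∑ i ∈ r.index, Δ (r.right i) * (antipode (r.left i) ⊗ₜ 1) = Δ 1 * (1 ⊗ₜ x) := by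
  rw [← rTensor_piRbar_comul, ← r.eq]
  have h := congrArg (TensorProduct.lift ((LinearMap.mul ℂ (A ⊗[ℂ] A)).flip ∘ₗ
    Algebra.TensorProduct.includeLeft.toLinearMap ∘ₗ antipode))
    (Coalgebra.sum_tmul_tmul_eq r (fun i => ℛ ℂ (r.left i)) fun i => ℛ ℂ (r.right i))
  simp only [map_sum, TensorProduct.lift.tmul, LinearMap.comp_apply, LinearMap.flip_apply,
    LinearMap.mul_apply', AlgHom.toLinearMap_apply, Algebra.TensorProduct.includeLeft_apply] at h
  simp only [← Finset.sum_mul, (ℛ ℂ _).eq] at h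
  rw [← h, map_sum]
  simp [piRbar_eq_sum hS, TensorProduct.sum_tmul]

lemma sum_haarER_mul_right (φ : Module.Dual ℂ A) (x : A) {ι : Type*} {y : A}
    (r : Coalgebra.Repr ℂ y ι) :
    ∑ i ∈ r.index, haarER (φ ∘ₗ LinearMap.mulRight ℂ (antipode (r.left i))) (x * r.right i) =
      haarER φ x * y := by
  let s : A ⊗[ℂ] A →ₗ[ℂ] A := (TensorProduct.lid ℂ A).toLinearMap ∘ₗ LinearMap.rTensor A φ
  have hs_mulRight (z : A ⊗[ℂ] A) (a : A) : (TensorProduct.lid ℂ A).toLinearMap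
      (LinearMap.rTensor A (φ ∘ₗ LinearMap.mulRight ℂ a) z) = s (z * (a ⊗ₜ 1)) := by
    induction z with
    | zero => simp
    | tmul u v => simp [s]
    | add u v hu hv => simp only [map_add, add_mul, hu, hv]
  calc _ = s (Δ x * ∑ i ∈ r.index, Δ (r.right i) * (antipode (r.left i) ⊗ₜ 1)) := by
        simp only [haarER, LinearMap.comp_apply, hs_mulRight, comul_mul, Finset.mul_sum, map_sum,
          mul_assoc]
    _ = s (Δ x * (1 ⊗ₜ y)) := by
        rw [sum_comul_right_mul_antipode_left hS, ← mul_assoc, comul_mul_comul_one]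
    _ = haarER φ x * y := by
        rw [haarER_apply (ℛ ℂ x), ← (ℛ ℂ x).eq]
        simp [s, Finset.sum_mul]

variable [FiniteDimensional ℂ A]

lemma regTrace_haarER (φ : Module.Dual ℂ A) (x : A) :
    χ (haarER φ x) = χ (x * haarER (φ ∘ₗ antipode) 1) := by
  let b := Module.finBasis ℂ A
  let R (a) : Module.End ℂ A := haarER (b.coord a)
  let G (a) : Module.End ℂ A := haarER (φ ∘ₗ LinearMap.mulRight ℂ (antipode (b a)))
  have hGR : LinearMap.mulLeft ℂ (haarER φ x) = ∑ a, G a * (LinearMap.mulLeft ℂ x * R a) := by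
    ext y
    simpa [reprOfBasis] using (sum_haarER_mul_right hS φ x (reprOfBasis b y)).symm
  have hRG : LinearMap.mulLeft ℂ (haarER (φ ∘ₗ antipode) 1) = ∑ a, R a * G a := by
    ext y
    simpa [haarER_comp_piL] using (sum_haarER_coord_haarER b φ y).symm
  rw [regTrace_apply, regTrace_apply, LinearMap.mulLeft_mul, ← Module.End.mul_eq_comp, hGR, hRG,
    Finset.mul_sum, map_sum, map_sum]
  exact Finset.sum_congr rfl fun a _ => by rw [LinearMap.trace_mul_comm, mul_assoc]

lemma haarEL_regTrace (x : A) :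
    haarEL χ x = antipode (haarEL (χ ∘ₗ LinearMap.mulLeft ℂ x) 1) := by
  refine Module.eval_apply_injective ℂ (LinearMap.ext fun φ => ?_)
  rw [Module.Dual.eval_apply, Module.Dual.eval_apply]
  rw [apply_haarEL, regTrace_haarER hS, ← LinearMap.mulLeft_apply (R := ℂ),
    ← LinearMap.comp_apply (f := χ), ← apply_haarEL, LinearMap.comp_apply]

lemma haarEL_regTrace_mem (x : A) : haarEL χ x ∈ leftSub A := by
  rw [haarEL_regTrace hS]; exact antipode_mem_left (haarEL_one_mem_right _)

lemma regTrace_antipode (hχ : ∀ x : A, (∀ y, χ (x * y) = 0) → x = 0) (x : A) :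
    χ (antipode x) = χ x := by
  have h : LinearMap.mulLeft ℂ (antipode x) = antipode ∘ₗ LinearMap.mulRight ℂ x ∘ₗ antipode := by
    ext y; simp [antipode_mul_antidistrib, hS _]
  rw [regTrace_apply, h, LinearMap.trace_comp_comm', LinearMap.comp_assoc,
    show antipode ∘ₗ antipode = (.id : A →ₗ[ℂ] A) from LinearMap.ext hS, LinearMap.comp_id,
    trace_mulRight_eq_regTrace hχ regTrace_mul_comm]

end Involutive

/-- The element `1₍₁₎ χ(1₍₂₎)`, which turns out to be the index of the Haar conditional
expectations. -/
def haarIndex : A := haarEL χ 1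

lemma haarIndex_mem_right : (haarIndex : A) ∈ rightSub A := haarEL_one_mem_right _

lemma haarIndex_comm (hS : Function.Involutive (antipode : A →ₗ[ℂ] A)) (x : A) :
    haarIndex * x = x * haarIndex :=
  haarEL_one_mul_comm hS regTrace_mul_comm x

variable [FiniteDimensional ℂ A]

lemma haarIndex_mem_left (hS : Function.Involutive (antipode : A →ₗ[ℂ] A)) :
    (haarIndex : A) ∈ leftSub A :=
  haarEL_regTrace_mem hS 1

lemma haarIndex_mem (hS : Function.Involutive (antipode : A →ₗ[ℂ] A)) :
    (haarIndex : A) ∈ hypercenter A :=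
  ⟨⟨haarIndex_mem_left hS, haarIndex_mem_right⟩,
    (Subalgebra.mem_center_iff (R := ℂ)).2 fun x => (haarIndex_comm hS x).symm⟩

end WeakHopf

section Spectrum

/-! ### Finite dimensional C*-algebras -/

variable {K A : Type*} [Field K] [Ring A] [Algebra K A]

lemma spectrum_lmul (a : A) : spectrum K (Algebra.lmul K A a) = spectrum K a := by
  ext c
  rw [spectrum.mem_iff, spectrum.mem_iff, ← AlgHom.commutes (Algebra.lmul K A) c, ← map_sub,
    Algebra.lmul_isUnit_iff]

lemma aeval_mul_of_mul_eq_smul {a x : A} {c : K} (h : a * x = c • x) (P : Polynomial K) :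
    Polynomial.aeval a P * x = P.eval c • x := by
  rcases eq_or_ne x 0 with rfl | hx
  · simp
  · have hev : Module.End.HasEigenvector (Algebra.lmul K A a) c x :=
      ⟨Module.End.mem_eigenspace_iff.2 h, hx⟩
    have := Module.End.aeval_apply_of_hasEigenvector (p := P) hev
    rwa [Polynomial.aeval_algHom_apply] at this

variable [FiniteDimensional K A]

lemma finite_spectrum (a : A) : (spectrum K a).Finite := by
  simpa only [spectrum_lmul] using Module.End.finite_spectrum (Algebra.lmul K A a)

lemma mem_spectrum_iff_exists_mul_eq_smul {a : A} {c : K} :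
    c ∈ spectrum K a ↔ ∃ x ≠ 0, a * x = c • x := by
  rw [← spectrum_lmul, ← Module.End.hasEigenvalue_iff_mem_spectrum]
  refine ⟨fun h => ?_, fun ⟨x, hx, h⟩ => ?_⟩
  · obtain ⟨x, hx⟩ := h.exists_hasEigenvector
    exact ⟨x, hx.2, hx.apply_eq_smul⟩
  · exact Module.End.hasEigenvalue_of_hasEigenvector ⟨Module.End.mem_eigenspace_iff.2 h, hx⟩

lemma finrank_range_mulLeft_lt {p q : A} (hqq : q * q = q) (hqp : q * p = q) (hpq : p * q = q)
    (hne : q ≠ p) : Module.finrank K (LinearMap.range (LinearMap.mulLeft K q)) <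
      Module.finrank K (LinearMap.range (LinearMap.mulLeft K p)) := by
  refine Submodule.finrank_lt_finrank_of_lt (lt_of_le_of_ne ?_ fun heq => hne ?_)
  · rintro _ ⟨x, rfl⟩
    exact ⟨q * x, by simp only [LinearMap.mulLeft_apply, ← mul_assoc, hpq]⟩
  · obtain ⟨y, hy⟩ : p ∈ LinearMap.range (LinearMap.mulLeft K q) := heq ▸ ⟨1, mul_one p⟩
    rw [← hqp, ← hy, LinearMap.mulLeft_apply, ← mul_assoc, hqq]

end Spectrum

section Star

variable {R : Type*} [Mul R] [StarMul R] {p x : R}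

lemma mul_star_of_mul_eq (hp : IsSelfAdjoint p) (h : x * p = x) : p * star x = star x := by
  simpa [hp.star_eq] using congrArg star h

lemma star_mul_of_mul_eq (hp : IsSelfAdjoint p) (h : p * x = x) : star x * p = star x := by
  simpa [hp.star_eq] using congrArg star h

lemma mul_eq_right_of_mul_eq_left (hp : IsSelfAdjoint p) (hx : IsSelfAdjoint x) (h : x * p = x) :
    p * x = x := by
  simpa [hx.star_eq] using mul_star_of_mul_eq hp h

lemma mul_eq_left_of_mul_eq_right (hp : IsSelfAdjoint p) (hx : IsSelfAdjoint x) (h : p * x = x) :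
    x * p = x := by
  simpa [hx.star_eq] using star_mul_of_mul_eq hp h

end Star

lemma mem_center_iff {R A : Type*} [CommSemiring R] [Semiring A] [Algebra R A] {x : A} :
    x ∈ Subalgebra.toSubmodule (Subalgebra.center R A) ↔ ∀ y, x * y = y * x := by
  simp only [Subalgebra.mem_toSubmodule, Subalgebra.mem_center_iff, eq_comm]

section CStar

variable {A : Type*} [CStarAlgebra A]

/-- The submodule `B` underlies a unital *-subalgebra of `A`. Subalgebras are kept as submodules,
as in the definition of a minimal projection. -/
structure IsStarSubalgebra (B : Submodule ℂ A) : Prop where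
  one_mem : 1 ∈ B
  mul_mem : ∀ x ∈ B, ∀ y ∈ B, x * y ∈ B
  star_mem : ∀ x ∈ B, star x ∈ B

namespace IsStarSubalgebra

lemma top : IsStarSubalgebra (⊤ : Submodule ℂ A) := ⟨trivial, by simp, by simp⟩

lemma center : IsStarSubalgebra (Subalgebra.toSubmodule (Subalgebra.center ℂ A)) where
  one_mem := Subalgebra.one_mem _
  mul_mem _ hx _ hy := Subalgebra.mul_mem _ hx hy
  star_mem _ hx := Set.star_mem_center hx

lemma inf {B C : Submodule ℂ A} (hB : IsStarSubalgebra B) (hC : IsStarSubalgebra C) :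
    IsStarSubalgebra (B ⊓ C) where
  one_mem := ⟨hB.one_mem, hC.one_mem⟩
  mul_mem x hx y hy := ⟨hB.mul_mem x hx.1 y hy.1, hC.mul_mem x hx.2 y hy.2⟩
  star_mem x hx := ⟨hB.star_mem x hx.1, hC.star_mem x hx.2⟩

lemma aeval_mem {B : Submodule ℂ A} (hB : IsStarSubalgebra B) {a : A} (ha : a ∈ B)
    (P : Polynomial ℂ) : Polynomial.aeval a P ∈ B := by
  let S : Subalgebra ℂ A := B.toSubalgebra hB.one_mem fun x y hx hy => hB.mul_mem x hx y hy
  exact Algebra.adjoin_le (S := S) (Set.singleton_subset_iff.2 ha)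
    (Polynomial.aeval_mem_adjoin_singleton ℂ a)

end IsStarSubalgebra

namespace IsFaithfulTrace

variable {t : A →ₗ[ℂ] ℂ}

lemma nondegenerate (ht : IsFaithfulTrace t) (x : A) (h : ∀ y, t (x * y) = 0) : x = 0 := by
  by_contra hx
  simpa [ht.trace, h] using ht.faithful x hx

lemma pos_of_isStarProjection (ht : IsFaithfulTrace t) {p : A} (hp : IsStarProjection p)
    (h0 : p ≠ 0) : 0 < t p := by
  simpa [hp.isSelfAdjoint.star_eq, hp.isIdempotentElem.eq] using ht.faithful p h0

-- Polarization: `t` is real on `y* y` for `y = x, 1 + x, 1 + i x`.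
lemma map_star (ht : IsFaithfulTrace t) (x : A) : t (star x) = star (t x) := by
  have him (y : A) : (t (star y * y)).im = 0 := by
    rcases eq_or_ne y 0 with rfl | hy
    · simp
    · exact (Complex.le_def.1 (ht.faithful y hy).le).2.symm
  have h_one : (t 1).im = 0 := by simpa using him 1
  have h_add := him (1 + x)
  have h_add_I := him (1 + Complex.I • x)
  simp only [star_add, star_one, star_smul, add_mul, mul_add, one_mul, mul_one, map_add,
    Complex.add_im, him, h_one, smul_mul_assoc, mul_smul_comm, map_smul, smul_eq_mul]
    at h_add h_add_I
  apply Complex.ext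
  · simp [him] at h_add_I ⊢
    linarith
  · simp at h_add ⊢
    linarith

end IsFaithfulTrace

namespace IsMinProj

variable {B : Submodule ℂ A} {p : A}

lemma mem (hp : IsMinProj B p) : p ∈ B := hp.1

lemma isStarProjection (hp : IsMinProj B p) : IsStarProjection p := hp.2.1

lemma isSelfAdjoint (hp : IsMinProj B p) : IsSelfAdjoint p := hp.2.1.isSelfAdjoint

lemma mul_self (hp : IsMinProj B p) : p * p = p := hp.2.1.isIdempotentElem

lemma ne_zero (hp : IsMinProj B p) : p ≠ 0 := hp.2.2.1

lemma eq_zero_or_eq (hp : IsMinProj B p) {q : A} (hqB : q ∈ B) (hq : IsStarProjection q)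
    (h : q * p = q) : q = 0 ∨ q = p :=
  hp.2.2.2 q hqB hq h

end IsMinProj

variable [FiniteDimensional ℂ A]

lemma exists_spectral_projection {B : Submodule ℂ A} (hB : IsStarSubalgebra B) {a : A} (ha : a ∈ B)
    (hsa : IsSelfAdjoint a) (c : ℂ) :
    ∃ q ∈ B, IsStarProjection q ∧ ∀ x, q * x = x ↔ a * x = c • x := by
  classical
  let s := (finite_spectrum (K := ℂ) a).toFinset
  let P := Lagrange.basis (insert c s) id c
  have eval_self : P.eval c = 1 :=
    Lagrange.eval_basis_self Function.injective_id.injOn (Finset.mem_insert_self c s)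
  have eval_of_ne (d : ℂ) (hd : d ∈ spectrum ℂ a) (hdc : d ≠ c) : P.eval d = 0 :=
    Lagrange.eval_basis_of_ne (v := id) hdc.symm (Finset.mem_insert_of_mem (by simpa [s]))
  have : IsStarNormal a := hsa.isStarNormal
  have cfc_congr_of_eq (f g : ℂ → ℂ) (hc : f c = g c)
      (h0 : ∀ d, P.eval d = 0 → f d = g d) : cfc f a = cfc g a := by
    refine cfc_congr fun d hd => ?_
    rcases eq_or_ne d c with rfl | hdc
    · exact hc
    · exact h0 d (eval_of_ne d hd hdc)
  have hq : cfc P.eval a = Polynomial.aeval a P := cfc_polynomial P a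
  have mul_self : cfc P.eval a * cfc P.eval a = cfc P.eval a := by
    rw [← cfc_mul P.eval P.eval a]
    exact cfc_congr_of_eq _ _ (by simp [eval_self]) (by simp +contextual)
  have star_eq : star (cfc P.eval a) = cfc P.eval a := by
    rw [← cfc_star]
    exact cfc_congr_of_eq _ _ (by simp [eval_self]) (by simp +contextual)
  have mul_eq : a * cfc P.eval a = c • cfc P.eval a := by
    calc a * cfc P.eval a = cfc (fun x => x * P.eval x) a := by
          rw [cfc_mul (fun x => x) P.eval a, cfc_id' ℂ a]
      _ = cfc (fun x => c • P.eval x) a :=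
        cfc_congr_of_eq _ _ (by simp) (by simp +contextual)
      _ = c • cfc P.eval a := cfc_smul c P.eval a
  refine ⟨cfc P.eval a, hq ▸ hB.aeval_mem ha P, ⟨mul_self, star_eq⟩,
    fun x => ⟨fun h => ?_, fun h => ?_⟩⟩
  · rw [← h, ← mul_assoc, mul_eq, smul_mul_assoc]
  · rw [hq, aeval_mul_of_mul_eq_smul h, eval_self, one_smul]

lemma regTrace_star_mul_self_pos {x : A} (hx : x ≠ 0) : 0 < χ (star x * x) := by
  have nonneg_of_mem_roots (c : ℂ)
      (hc : c ∈ (LinearMap.charpoly (Algebra.lmul ℂ A (star x * x))).roots) : 0 ≤ c := by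
    let _ := CStarAlgebra.spectralOrder A
    have _ := CStarAlgebra.spectralOrderedRing A
    refine spectrum_nonneg_of_nonneg (star_mul_self_nonneg x) ?_
    rw [← spectrum_lmul, Module.End.mem_spectrum_iff_isRoot_charpoly]
    exact Polynomial.isRoot_of_mem_roots hc
  have trace_eq : χ (star x * x) =
      (LinearMap.charpoly (Algebra.lmul ℂ A (star x * x))).roots.sum :=
    Module.End.trace_eq_sum_roots_charpoly_of_splits (IsAlgClosed.splits _)
  rw [trace_eq]
  refine lt_of_le_of_ne (Multiset.sum_nonneg nonneg_of_mem_roots) fun h => hx ?_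
  have eq_zero_of_mem_roots :=
    Multiset.all_zero_of_le_zero_le_of_sum_eq_zero nonneg_of_mem_roots h.symm
  refine (CStarRing.star_mul_self_eq_zero_iff x).1 (CFC.eq_zero_of_spectrum_subset_zero (R := ℂ) _
    (fun c hc => eq_zero_of_mem_roots c ?_) (IsSelfAdjoint.star_mul_self x).isStarNormal)
  rw [Polynomial.mem_roots (LinearMap.charpoly_monic _).ne_zero,
    ← Module.End.mem_spectrum_iff_isRoot_charpoly, spectrum_lmul]
  exact hc

lemma isFaithfulTrace_regTrace : IsFaithfulTrace (χ : A →ₗ[ℂ] ℂ) where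
  trace := regTrace_mul_comm
  faithful _ := regTrace_star_mul_self_pos

section MinimalProjections

variable {B : Submodule ℂ A}

lemma IsMinProj.exists_eq_smul_of_isSelfAdjoint (hB : IsStarSubalgebra B) {p : A}
    (hp : IsMinProj B p) {a : A} (ha : a ∈ B) (hsa : IsSelfAdjoint a) (hpa : p * a = a) :
    ∃ c : ℂ, a = c • p := by
  rcases eq_or_ne a 0 with rfl | ha0
  · exact ⟨0, (zero_smul ℂ p).symm⟩
  obtain ⟨c, hc, hc0⟩ : ∃ c ∈ spectrum ℂ a, c ≠ 0 := by
    by_contra! h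
    exact ha0 (CFC.eq_zero_of_spectrum_subset_zero (R := ℂ) a (fun c hc => h c hc)
      hsa.isStarNormal)
  obtain ⟨x, hx, hax⟩ := mem_spectrum_iff_exists_mul_eq_smul.1 hc
  obtain ⟨q, hqB, hq, hqx⟩ := exists_spectral_projection hB ha hsa c
  have haq : a * q = c • q := (hqx q).1 hq.isIdempotentElem
  have hpq : p * q = q := smul_right_injective A hc0 <| by
    simp only [← mul_smul_comm, ← haq, ← mul_assoc, hpa]
  rcases hp.eq_zero_or_eq hqB hq
    (mul_eq_left_of_mul_eq_right hp.isSelfAdjoint hq.isSelfAdjoint hpq) with rfl | rfl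
  · exact absurd ((hqx x).2 hax) (by simpa using hx.symm)
  · exact ⟨c, by rw [← haq, mul_eq_left_of_mul_eq_right hp.isSelfAdjoint hsa hpa]⟩

lemma IsMinProj.exists_mul_mul_eq_smul (hB : IsStarSubalgebra B) {p : A} (hp : IsMinProj B p)
    {b : A} (hb : b ∈ B) : ∃ c : ℂ, p * b * p = c • p := by
  have compress {a : A} (ha : a ∈ B) (hsa : IsSelfAdjoint a) : ∃ c : ℂ, p * a * p = c • p := by
    refine hp.exists_eq_smul_of_isSelfAdjoint hB (hB.mul_mem _ (hB.mul_mem _ hp.mem _ ha) _ hp.mem)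
      (hsa.conjugate_self hp.isSelfAdjoint) ?_
    rw [← mul_assoc, ← mul_assoc, hp.mul_self]
  have hre : (realPart b : A) ∈ B := by
    rw [realPart_apply_coe]
    exact B.smul_of_tower_mem _ (B.add_mem hb (hB.star_mem b hb))
  have him : (imaginaryPart b : A) ∈ B := by
    rw [imaginaryPart_apply_coe]
    exact B.smul_mem _ (B.smul_of_tower_mem _ (B.sub_mem hb (hB.star_mem b hb)))
  obtain ⟨c, hc⟩ := compress hre (realPart b).2
  obtain ⟨d, hd⟩ := compress him (imaginaryPart b).2
  refine ⟨c + Complex.I * d, ?_⟩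
  rw [← realPart_add_I_smul_imaginaryPart b, mul_add, add_mul, hc, mul_smul_comm, smul_mul_assoc,
    hd, add_smul, mul_smul]

lemma IsMinProj.exists_mul_eq_smul (hB : IsStarSubalgebra B) {p : A} (hp : IsMinProj B p)
    {b : A} (hb : b ∈ B) (hbp : Commute b p) : ∃ c : ℂ, b * p = c • p := by
  obtain ⟨c, hc⟩ := hp.exists_mul_mul_eq_smul hB hb
  exact ⟨c, by rw [← hc, ← hbp.eq, mul_assoc, hp.mul_self]⟩

lemma exists_isMinProj_le {g : A} (hg : g ∈ B) (hgp : IsStarProjection g) (h0 : g ≠ 0) :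
    ∃ p, IsMinProj B p ∧ p * g = p := by
  induction hn : Module.finrank ℂ (LinearMap.range (LinearMap.mulLeft ℂ g))
    using Nat.strong_induction_on generalizing g with
  | _ n ih =>
    by_cases hmin : IsMinProj B g
    · exact ⟨g, hmin, hgp.isIdempotentElem⟩
    · simp only [IsMinProj, hg, hgp, ne_eq, h0, not_false_eq_true, true_and, not_forall,
        not_or] at hmin
      obtain ⟨q, hq, hqp, hqg, hq0, hne⟩ := hmin
      have hgq := mul_eq_right_of_mul_eq_left hgp.isSelfAdjoint hqp.isSelfAdjoint hqg
      obtain ⟨p, hp, hpq⟩ :=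
        ih _ (hn ▸ finrank_range_mulLeft_lt hqp.isIdempotentElem hqg hgq hne) hq hqp hq0 rfl
      exact ⟨p, hp, by rw [← hpq, mul_assoc, hqg]⟩

lemma starProjection_induction {P : A → Prop} (zero : P 0)
    (add : ∀ a ∈ B, ∀ p, IsStarProjection a → IsMinProj B p → a * p = 0 → P a → P p → P (a + p))
    (minimal : ∀ p, IsMinProj B p → P p) {g : A} (hg : g ∈ B) (hgp : IsStarProjection g) :
    P g := by
  induction hn : Module.finrank ℂ (LinearMap.range (LinearMap.mulLeft ℂ g))
    using Nat.strong_induction_on generalizing g with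
  | _ n ih =>
    rcases eq_or_ne g 0 with rfl | hg0
    · exact zero
    obtain ⟨p, hp, hpg⟩ := exists_isMinProj_le hg hgp hg0
    have hgp_mul := mul_eq_right_of_mul_eq_left hgp.isSelfAdjoint hp.isSelfAdjoint hpg
    have hgg : g * g = g := hgp.isIdempotentElem
    have hsub := hp.isStarProjection.sub_of_mul_eq_left hgp hpg
    have hlt := finrank_range_mulLeft_lt (K := ℂ) hsub.isIdempotentElem
      (by rw [sub_mul, hgg, hpg]) (by rw [mul_sub, hgg, hgp_mul])
      (fun h => hp.ne_zero (by simpa using h))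
    rw [← sub_add_cancel g p]
    exact add (g - p) (B.sub_mem hg hp.mem) p hsub hp
      (by rw [sub_mul, hgp_mul, hp.mul_self, sub_self])
      (ih _ (hn ▸ hlt) (B.sub_mem hg hp.mem) hsub rfl) (minimal p hp)

end MinimalProjections

end CStar

section Sectors

/-! ### Minimal projections and inclusion matrices -/

lemma linearIndependent_of_orthogonalIdempotents {K R ι : Type*} [DivisionRing K] [Ring R]
    [Module K R] [SMulCommClass K R R] {e : ι → R} (he : OrthogonalIdempotents e)
    (h0 : ∀ i, e i ≠ 0) : LinearIndependent K e := by
  rw [linearIndependent_iff']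
  intro s c hc i hi
  have h := congrArg (e i * ·) hc
  simp only [Finset.mul_sum, mul_smul_comm, mul_zero] at h
  rw [Finset.sum_eq_single i (fun j _ hj => by rw [he.ortho hj.symm, smul_zero])
    (fun h => absurd hi h), he.idem i] at h
  exact (smul_eq_zero.1 h).resolve_right (h0 i)

variable {A : Type*} [CStarAlgebra A] {B : Submodule ℂ A}

lemma cons_pairwise_inequivalent (hB : IsStarSubalgebra B) {n : ℕ} {e : Fin n → A} {p : A}
    (he : ∀ i, IsMinProj B (e i)) (hp : IsMinProj B p)
    (hne : Pairwise fun i j => ∀ x ∈ B, e i * x * e j = 0) (hpe : ∀ i, ∀ x ∈ B, p * x * e i = 0) :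
    Pairwise fun i j => ∀ x ∈ B,
      (Fin.cons p e : Fin (n + 1) → A) i * x * (Fin.cons p e : Fin (n + 1) → A) j = 0 := by
  intro i j
  cases i using Fin.cases <;> cases j using Fin.cases
  case zero.zero => exact fun h => absurd rfl h
  case zero.succ j => exact fun _ x hx => hpe j x hx
  case succ.zero i =>
    intro _ x hx
    simpa [hp.isSelfAdjoint.star_eq, (he i).isSelfAdjoint.star_eq, mul_assoc]
      using congrArg star (hpe i (star x) (hB.star_mem x hx))
  case succ.succ i j => exact fun h x hx => hne (fun hij => h (congrArg Fin.succ hij)) x hx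

variable [FiniteDimensional ℂ A]

lemma exists_isSectorSystem (hB : IsStarSubalgebra B) :
    ∃ (n : ℕ) (e : Fin n → A), IsSectorSystem B e := by
  by_contra! not_exhaustive
  have arbitrarily_long (n : ℕ) : ∃ e : Fin n → A, (∀ i, IsMinProj B (e i)) ∧
      Pairwise fun i j => ∀ x ∈ B, e i * x * e j = 0 := by
    induction n with
    | zero => exact ⟨Fin.elim0, fun i => i.elim0, fun i => i.elim0⟩
    | succ n ih =>
      obtain ⟨e, he, hne⟩ := ih
      obtain ⟨p, hp, hpe⟩ : ∃ p, IsMinProj B p ∧ ∀ i, ∀ x ∈ B, p * x * e i = 0 := by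
        by_contra! h
        exact not_exhaustive n e ⟨he, fun i j hij => hne hij, fun p hp => h p hp⟩
      exact ⟨Fin.cons p e, Fin.forall_fin_succ.2 ⟨hp, he⟩,
        cons_pairwise_inequivalent hB he hp hne hpe⟩
  obtain ⟨e, he, hne⟩ := arbitrarily_long (Module.finrank ℂ A + 1)
  have orthogonal : OrthogonalIdempotents e :=
    ⟨fun i => (he i).mul_self, fun i j hij => by simpa using hne hij 1 hB.one_mem⟩
  simpa using (linearIndependent_of_orthogonalIdempotents (K := ℂ) orthogonal
    fun i => (he i).ne_zero).fintype_card_le_finrank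

section Equivalence

variable {p e x : A}

lemma IsMinProj.exists_mul_star_eq_smul (hB : IsStarSubalgebra B) (hp : IsMinProj B p)
    (he : IsMinProj B e) (hx : x ∈ B) (h : p * x * e ≠ 0) :
    ∃ c : ℂ, c ≠ 0 ∧ p * x * e * star (p * x * e) = c • p ∧
      star (p * x * e) * (p * x * e) = c • e := by
  set v := p * x * e with hv
  have hvB : v ∈ B := hB.mul_mem _ (hB.mul_mem _ hp.mem _ hx) _ he.mem
  have hpv : p * v = v := by rw [hv, ← mul_assoc, ← mul_assoc, hp.mul_self]
  have hve : v * e = v := by rw [hv, mul_assoc, he.mul_self]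
  obtain ⟨c, hc⟩ := hp.exists_mul_mul_eq_smul hB (hB.mul_mem _ hvB _ (hB.star_mem _ hvB))
  obtain ⟨d, hd⟩ := he.exists_mul_mul_eq_smul hB (hB.mul_mem _ (hB.star_mem _ hvB) _ hvB)
  rw [← mul_assoc, hpv, mul_assoc, star_mul_of_mul_eq hp.isSelfAdjoint hpv] at hc
  rw [← mul_assoc, mul_star_of_mul_eq he.isSelfAdjoint hve, mul_assoc, hve] at hd
  have hcd : c = d := smul_left_injective ℂ h <| by
    calc c • v = v * star v * v := by rw [hc, smul_mul_assoc, hpv]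
      _ = d • v := by rw [mul_assoc, hd, mul_smul_comm, hve]
  refine ⟨c, ?_, hc, hcd ▸ hd⟩
  rintro rfl
  rw [zero_smul, CStarRing.mul_star_self_eq_zero_iff] at hc
  exact h hc

lemma IsMinProj.apply_eq_of_mul_ne_zero (hB : IsStarSubalgebra B) (hp : IsMinProj B p)
    (he : IsMinProj B e) (hx : x ∈ B) (h : p * x * e ≠ 0) {σ : A →ₗ[ℂ] ℂ}
    (hσ : ∀ a ∈ B, ∀ b ∈ B, σ (a * b) = σ (b * a)) : σ p = σ e := by
  obtain ⟨c, hc, hp_eq, he_eq⟩ := hp.exists_mul_star_eq_smul hB he hx h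
  have hv : p * x * e ∈ B := hB.mul_mem _ (hB.mul_mem _ hp.mem _ hx) _ he.mem
  refine mul_left_cancel₀ hc ?_
  simp only [← smul_eq_mul, ← map_smul, ← hp_eq, ← he_eq]
  exact hσ _ hv _ (hB.star_mem _ hv)

lemma IsMinProj.mul_mul_eq_zero (hB : IsStarSubalgebra B) (hp : IsMinProj B p)
    (he : IsMinProj B e) (hx : x ∈ B) (h : p * x * e ≠ 0) {f : A}
    (hef : ∀ y ∈ B, e * y * f = 0) {y : A} (hy : y ∈ B) : p * y * f = 0 := by
  obtain ⟨c, hc, hp_eq, -⟩ := hp.exists_mul_star_eq_smul hB he hx h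
  have hv : p * x * e ∈ B := hB.mul_mem _ (hB.mul_mem _ hp.mem _ hx) _ he.mem
  refine (smul_eq_zero.1 (?_ : c • (p * y * f) = 0)).resolve_left hc
  calc c • (p * y * f) = p * x * (e * (star (p * x * e) * y) * f) := by
        simp only [← smul_mul_assoc, ← hp_eq, mul_assoc]
    _ = 0 := by rw [hef _ (hB.mul_mem _ (hB.star_mem _ hv) _ hy), mul_zero]

end Equivalence

/-- The dimension of the corner `g B e`. For `B = A`, with one of `g`, `e` a minimal projection of
`A` and the other of a subalgebra, these are the entries of the inclusion matrix. -/
def cornerDim (B : Submodule ℂ A) (g e : A) : ℕ :=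
  Module.finrank ℂ (B.map (LinearMap.mulLeft ℂ g ∘ₗ LinearMap.mulRight ℂ e))

section CornerDim

variable {g e : A}

omit [FiniteDimensional ℂ A] in
lemma inclusionMult_eq_cornerDim (e f : A) : inclusionMult e f = cornerDim ⊤ f e := by
  rw [inclusionMult, cornerDim, LinearMap.range_eq_map]

lemma cornerDim_eq_trace (hB : IsStarSubalgebra B) {E : A →ₗ[ℂ] A} (hE : LinearMap.IsProj B E)
    (hg : g ∈ B) (he : e ∈ B) (hgg : g * g = g) (hee : e * e = e) : (cornerDim B g e : ℂ) =
      LinearMap.trace ℂ A (LinearMap.mulLeft ℂ g ∘ₗ LinearMap.mulRight ℂ e ∘ₗ E) := by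
  have isProj : LinearMap.IsProj (B.map (LinearMap.mulLeft ℂ g ∘ₗ LinearMap.mulRight ℂ e))
      (LinearMap.mulLeft ℂ g ∘ₗ LinearMap.mulRight ℂ e ∘ₗ E) := by
    refine ⟨fun x => ⟨E x, hE.map_mem x, rfl⟩, ?_⟩
    rintro _ ⟨x, hx, rfl⟩
    have hm : g * (x * e) ∈ B := hB.mul_mem _ hg _ (hB.mul_mem _ hx _ he)
    simp only [LinearMap.comp_apply, LinearMap.mulLeft_apply, LinearMap.mulRight_apply,
      hE.map_id _ hm]
    rw [mul_assoc g, mul_assoc x, hee, ← mul_assoc g g, hgg]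
  exact isProj.trace.symm

lemma cornerDim_add (hB : IsStarSubalgebra B) {p : A} (hg : g ∈ B) (hp : p ∈ B) (he : e ∈ B)
    (hgg : g * g = g) (hpp : p * p = p) (hee : e * e = e) (hgp : (g + p) * (g + p) = g + p) :
    cornerDim B (g + p) e = cornerDim B g e + cornerDim B p e := by
  obtain ⟨f, hf⟩ := B.subtype.exists_leftInverse_of_injective B.ker_subtype
  have hE : LinearMap.IsProj B (B.subtype ∘ₗ f) :=
    ⟨fun x => (f x).2, fun b hb => congrArg B.subtype (LinearMap.congr_fun hf ⟨b, hb⟩)⟩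
  have mulLeft_add : LinearMap.mulLeft ℂ (g + p) = LinearMap.mulLeft ℂ g + LinearMap.mulLeft ℂ p :=
    map_add (LinearMap.mul ℂ A) g p
  have h := cornerDim_eq_trace hB hE (B.add_mem hg hp) he hgp hee
  rw [mulLeft_add, LinearMap.add_comp, map_add, ← cornerDim_eq_trace hB hE hg he hgg hee,
    ← cornerDim_eq_trace hB hE hp he hpp hee] at h
  exact_mod_cast h

lemma IsMinProj.cornerDim_eq_one (hB : IsStarSubalgebra B) {p x : A} (hp : IsMinProj B p)
    (he : IsMinProj B e) (hx : x ∈ B) (h : p * x * e ≠ 0) : cornerDim B p e = 1 := by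
  obtain ⟨c, hc, hp_eq, -⟩ := hp.exists_mul_star_eq_smul hB he hx h
  set v := p * x * e with hv
  have hvB : v ∈ B := hB.mul_mem _ (hB.mul_mem _ hp.mem _ hx) _ he.mem
  have hve : v * e = v := by rw [hv, mul_assoc, he.mul_self]
  suffices B.map (LinearMap.mulLeft ℂ p ∘ₗ LinearMap.mulRight ℂ e) = ℂ ∙ v by
    rw [cornerDim, this, finrank_span_singleton h]
  refine le_antisymm ?_ ((Submodule.span_singleton_le_iff_mem _ _).2
    ⟨x, hx, by simp [hv, mul_assoc]⟩)
  rintro _ ⟨y, hy, rfl⟩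
  obtain ⟨d, hd⟩ := he.exists_mul_mul_eq_smul hB (hB.mul_mem _ (hB.star_mem _ hvB) _ hy)
  refine Submodule.mem_span_singleton.2 ⟨c⁻¹ * d, ?_⟩
  calc (c⁻¹ * d) • v = c⁻¹ • (v * (d • e)) := by rw [mul_smul_comm, hve, smul_smul]
    _ = c⁻¹ • (v * e * star v * y * e) := by simp only [← hd, mul_assoc]
    _ = p * (y * e) := by
      rw [hve, hp_eq, smul_mul_assoc, smul_mul_assoc, inv_smul_smul₀ hc, mul_assoc]

lemma cornerDim_eq_zero (h : ∀ y ∈ B, g * y * e = 0) : cornerDim B g e = 0 := by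
  rw [cornerDim, Submodule.finrank_eq_zero, Submodule.eq_bot_iff]
  rintro _ ⟨y, hy, rfl⟩
  simpa [mul_assoc] using h y hy

theorem IsSectorSystem.sum_cornerDim_mul (hB : IsStarSubalgebra B) {n : ℕ} {e : Fin n → A}
    (he : IsSectorSystem B e) {σ : A →ₗ[ℂ] ℂ} (hσ : ∀ a ∈ B, ∀ b ∈ B, σ (a * b) = σ (b * a))
    (hg : g ∈ B) (hgp : IsStarProjection g) : ∑ i, (cornerDim B g (e i) : ℂ) * σ (e i) = σ g := by
  refine starProjection_induction (B := B)
    (P := fun g => ∑ i, (cornerDim B g (e i) : ℂ) * σ (e i) = σ g) ?_ ?_ ?_ hg hgp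
  · simp [cornerDim_eq_zero]
  · intro a ha p hap hp hmul ih_a ih_p
    have hsum := hap.add hp.isStarProjection hmul
    simp only [cornerDim_add hB ha hp.mem (he.minimal _).mem hap.isIdempotentElem hp.mul_self
      (he.minimal _).mul_self hsum.isIdempotentElem, Nat.cast_add, add_mul,
      Finset.sum_add_distrib, ih_a, ih_p, map_add]
  · intro p hp
    obtain ⟨i, x, hx, hne⟩ := he.exhaustive p hp
    rw [Finset.sum_eq_single i, hp.cornerDim_eq_one hB (he.minimal i) hx hne, Nat.cast_one, one_mul,
      hp.apply_eq_of_mul_ne_zero hB (he.minimal i) hx hne hσ]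
    · intro j _ hj
      rw [cornerDim_eq_zero fun y hy =>
        hp.mul_mul_eq_zero hB (he.minimal i) hx hne (he.inequivalent i j hj.symm) hy]
      simp
    · simp

end CornerDim

end Sectors

section TraceLemmas

/-! ### Conditional expectations compatible with the regular traces -/

variable {K A : Type*} [Field K] [Ring A] [Algebra K A]

lemma apply_central_mul_mul_comm {t : A →ₗ[K] K} (ht : ∀ x y, t (x * y) = t (y * x)) {c : A}
    (hc : ∀ x, c * x = x * c) (x y : A) : t (c * (x * y)) = t (c * (y * x)) := by
  rw [← mul_assoc, hc, mul_assoc, ht, mul_assoc]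

/-- The bilinear form `(x, y) ↦ tr(a ↦ x a y)`; at idempotents `f` and `e` its value is
`dim f A e`. -/
def bimodTrace (K : Type*) {A : Type*} [Field K] [Ring A] [Algebra K A] : A →ₗ[K] A →ₗ[K] K :=
  ((LinearMap.mul K (Module.End K A)).compl₁₂ (LinearMap.mul K A)
    (LinearMap.mul K A).flip).compr₂ (LinearMap.trace K A)

lemma bimodTrace_apply (x y : A) : bimodTrace K x y =
    LinearMap.trace K A (LinearMap.mulLeft K x ∘ₗ LinearMap.mulRight K y) := rfl

lemma bimodTrace_mul_comm_left (x y a : A) :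
    bimodTrace K (x * y) a = bimodTrace K (y * x) a := by
  have mulLeft_comp (x y : A) : LinearMap.mulLeft K (x * y) ∘ₗ LinearMap.mulRight K a =
      LinearMap.mulLeft K x * (LinearMap.mulLeft K y ∘ₗ LinearMap.mulRight K a) := by
    ext; simp
  have comp_mulLeft (x y : A) : LinearMap.mulLeft K (x * y) ∘ₗ LinearMap.mulRight K a =
      (LinearMap.mulLeft K x ∘ₗ LinearMap.mulRight K a) * LinearMap.mulLeft K y := by
    ext; simp [mul_assoc]
  rw [bimodTrace_apply, mulLeft_comp, LinearMap.trace_mul_comm, ← comp_mulLeft, bimodTrace_apply]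

lemma bimodTrace_mul_comm_right (a x y : A) :
    bimodTrace K a (x * y) = bimodTrace K a (y * x) := by
  have comp_mulRight (x y : A) : LinearMap.mulLeft K a ∘ₗ LinearMap.mulRight K (x * y) =
      (LinearMap.mulLeft K a ∘ₗ LinearMap.mulRight K y) * LinearMap.mulRight K x := by
    ext; simp [mul_assoc]
  have mulRight_comp (x y : A) : LinearMap.mulLeft K a ∘ₗ LinearMap.mulRight K (x * y) =
      LinearMap.mulRight K y * (LinearMap.mulLeft K a ∘ₗ LinearMap.mulRight K x) := by
    ext; simp [mul_assoc]
  rw [bimodTrace_apply, comp_mulRight, LinearMap.trace_mul_comm, ← mulRight_comp, bimodTrace_apply]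

lemma bimodTrace_of_central_right (x : A) {y : A} (hy : ∀ a, y * a = a * y) :
    bimodTrace K x y = regTrace K (x * y) := by
  rw [bimodTrace_apply, regTrace_apply]
  congr 1
  ext a
  simp [hy]

variable [FiniteDimensional K A]

lemma bimodTrace_of_central_left {t : A →ₗ[K] K} (ht : ∀ x, (∀ y, t (x * y) = 0) → x = 0)
    (htr : ∀ x y, t (x * y) = t (y * x)) {x : A} (hx : ∀ a, x * a = a * x) (y : A) :
    bimodTrace K x y = regTrace K (x * y) := by
  rw [← trace_mulRight_eq_regTrace ht htr, bimodTrace_apply]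
  congr 1
  ext a
  simp only [LinearMap.comp_apply, LinearMap.mulLeft_apply, LinearMap.mulRight_apply]
  rw [← mul_assoc, hx, mul_assoc]

lemma trace_comp_eq_sum {t : A →ₗ[K] K} {E : A →ₗ[K] A} {n : ℕ} {u v : Fin n → A}
    (hE : ∀ x, E x = ∑ i, t (v i * x) • u i) (f : A →ₗ[K] A) :
    LinearMap.trace K A (f ∘ₗ E) = ∑ i, t (v i * f (u i)) := by
  have : f ∘ₗ E = ∑ i, (t ∘ₗ LinearMap.mulLeft K (v i)).smulRight (f (u i)) := by
    ext x; simp [hE]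
  simp [this]

lemma finrank_range_mulLeft {g : A} (hg : g * g = g) :
    (Module.finrank K (LinearMap.range (LinearMap.mulLeft K g)) : K) = regTrace K g := by
  have isProj :
      LinearMap.IsProj (LinearMap.range (LinearMap.mulLeft K g)) (LinearMap.mulLeft K g) := by
    refine ⟨fun x => ⟨x, rfl⟩, ?_⟩
    rintro _ ⟨x, rfl⟩
    simp only [LinearMap.mulLeft_apply, ← mul_assoc, hg]
  exact isProj.trace.symm

lemma regTrace_tmul {B : Type*} [Ring B] [Algebra K B] [FiniteDimensional K B] (x : A) (y : B) :
    regTrace K (x ⊗ₜ[K] y) = regTrace K x * regTrace K y := by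
  have mulLeft_tmul : LinearMap.mulLeft K (x ⊗ₜ[K] y) =
      TensorProduct.map (LinearMap.mulLeft K x) (LinearMap.mulLeft K y) :=
    TensorProduct.ext' fun _ _ => by simp
  simp only [regTrace_apply, mulLeft_tmul, LinearMap.trace_tensorProduct']

end TraceLemmas

lemma exists_natCast_eq_of_isIntegral {F : Type*} [Field F] [CharZero F] {r : F} {a b : ℕ}
    (hr : IsIntegral ℤ r) (hb : b ≠ 0) (h : r * b = a) : ∃ k : ℕ, r = k := by
  obtain rfl : r = algebraMap ℚ F (a / b : ℚ) := by
    rw [eq_div_of_mul_eq (Nat.cast_ne_zero.2 hb) h]; simp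
  rw [isIntegral_algebraMap_iff (algebraMap ℚ F).injective, IsIntegrallyClosed.isIntegral_iff] at hr
  obtain ⟨c, hc⟩ := hr
  have hc0 : 0 ≤ c := by
    have : (0 : ℚ) ≤ c := by
      rw [← eq_intCast (algebraMap ℤ ℚ), hc]; positivity
    exact_mod_cast this
  lift c to ℕ using hc0
  exact ⟨c, by rw [← hc]; simp⟩

section CStar

variable {A : Type*} [CStarAlgebra A]

lemma IsCondExp.isProj {B : Submodule ℂ A} {E : A →ₗ[ℂ] A} (hE : IsCondExp B E) :
    LinearMap.IsProj B E := ⟨hE.mem, hE.apply_of_mem⟩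

/-- `E` is an `h`-preserving conditional expectation onto `B` for a faithful trace `h` whose
restriction to `B` is the regular trace of `B` (this is what the two sums over the dual bases
`uᵢ`, `vᵢ` of `B` say), while the regular trace of `A` is `h(K ·)` for a central element `K` of
`B`. Such an `E` has index `K`. -/
structure IsRegularCondExp (B : Submodule ℂ A) (h : A →ₗ[ℂ] ℂ) (E : A →ₗ[ℂ] A) (K : A) : Prop where
  isStarSubalgebra : IsStarSubalgebra B
  faithful : IsFaithfulTrace h
  condExp : IsCondExp B E
  map_exp : ∀ x, h (E x) = h x
  exists_casimir : ∃ (n : ℕ) (u v : Fin n → A), (∀ x, E x = ∑ i, h (v i * x) • u i) ∧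
    ∑ i, v i * u i = 1 ∧ ∑ i, u i * v i = 1
  index_mem : K ∈ B
  index_comm : ∀ x, K * x = x * K
  regTrace_eq : ∀ x, χ x = h (K * x)

lemma IsMinProj.mul_eq_zero_or_mul_eq {B : Submodule ℂ A} {p z : A} (hp : IsMinProj B p)
    (hz : IsStarProjection z) (hzp : z * p ∈ B) (hc : Commute z p) : z * p = 0 ∨ z * p = p :=
  hp.eq_zero_or_eq hzp (hz.mul hp.isStarProjection hc) (by rw [mul_assoc, hp.mul_self])

section FiniteDimensional

variable [FiniteDimensional ℂ A]

lemma inclusionMult_eq_bimodTrace {e f : A} (hf : f * f = f) (he : e * e = e) :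
    (inclusionMult e f : ℂ) = bimodTrace ℂ f e := by
  rw [inclusionMult_eq_cornerDim, cornerDim_eq_trace .top (E := LinearMap.id)
    ⟨fun _ => trivial, fun _ _ => rfl⟩ trivial trivial hf he, LinearMap.comp_id, bimodTrace_apply]

lemma IsSectorSystem.sum_inclusionMult_mul {n : ℕ} {e : Fin n → A}
    (he : IsSectorSystem (⊤ : Submodule ℂ A) e) {σ : A →ₗ[ℂ] ℂ} (hσ : ∀ a b, σ (a * b) = σ (b * a))
    {g : A} (hg : IsStarProjection g) : ∑ i, (inclusionMult (e i) g : ℂ) * σ (e i) = σ g := by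
  simpa only [inclusionMult_eq_cornerDim] using
    he.sum_cornerDim_mul .top (fun a _ b _ => hσ a b) trivial hg

lemma IsSectorSystem.exists_mul_ne_zero {n : ℕ} {e : Fin n → A}
    (he : IsSectorSystem (⊤ : Submodule ℂ A) e) {g : A} (hg : IsStarProjection g) (h0 : g ≠ 0) :
    ∃ i x, g * x * e i ≠ 0 := by
  obtain ⟨p, hp, hpg⟩ := exists_isMinProj_le (B := ⊤) trivial hg h0
  obtain ⟨i, x, _, hx⟩ := he.exhaustive p hp
  refine ⟨i, x, fun h => hx ?_⟩
  rw [← hpg, mul_assoc, mul_assoc, ← mul_assoc g, h, mul_zero]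

end FiniteDimensional

namespace IsRegularCondExp

variable {B : Submodule ℂ A} {h : A →ₗ[ℂ] ℂ} {E : A →ₗ[ℂ] A} {K : A}

lemma isPreservingCondExp (H : IsRegularCondExp B h E K) {k : A} (hk : k ∈ B) {τ : A →ₗ[ℂ] ℂ}
    (hτ : ∀ x, τ x = h (k * x)) : IsPreservingCondExp B τ E := by
  refine ⟨H.condExp, fun b hb x => ?_⟩
  have hE : E (k * b * x) = k * b * E x := by
    simpa using H.condExp.bimodule (k * b) (H.isStarSubalgebra.mul_mem _ hk _ hb) 1
      H.isStarSubalgebra.one_mem x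
  rw [hτ, hτ, ← mul_assoc, ← hE, H.map_exp, mul_assoc]

lemma map_comm (H : IsRegularCondExp B h E K) {k : A} (hk : ∀ x, k * x = x * k) {b : A}
    (hb : b ∈ B) : E k * b = b * E k := by
  have left := H.condExp.bimodule b hb 1 H.isStarSubalgebra.one_mem k
  have right := H.condExp.bimodule 1 H.isStarSubalgebra.one_mem b hb k
  rw [mul_one, mul_one] at left
  rw [one_mul, one_mul] at right
  rw [← left, ← right, hk]

lemma apply_map_mul (H : IsRegularCondExp B h E K) {b : A} (hb : b ∈ B) (x : A) :
    h (E x * b) = h (x * b) := by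
  have := H.condExp.bimodule 1 H.isStarSubalgebra.one_mem b hb x
  rw [one_mul, one_mul] at this
  rw [← this, H.map_exp]

variable [FiniteDimensional ℂ A]

lemma hasIndex (H : IsRegularCondExp B h E K) : HasIndex B E K := by
  obtain ⟨n, a, b, sum_smul_left, sum_smul_right, trace_eq⟩ :=
    exists_dual_bases H.faithful.nondegenerate
  obtain ⟨m, u, v, hE, hvu, huv⟩ := H.exists_casimir
  have trace := H.faithful.trace
  refine ⟨H.condExp, n, a, b, fun x => ?_, fun x => ?_, ?_⟩
  · have contract (k) : ∑ i, a i * h (v k * (b i * x)) • u k = x * v k * u k := by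
      conv_rhs => rw [← sum_smul_left (x * v k)]
      rw [Finset.sum_mul]
      refine Finset.sum_congr rfl fun i _ => ?_
      rw [trace, mul_smul_comm, smul_mul_assoc, mul_assoc]
    simp only [hE, Finset.mul_sum]
    rw [Finset.sum_comm]
    simp only [contract, mul_assoc, ← Finset.mul_sum, hvu, mul_one]
  · have contract (k) : ∑ i, h (v k * (x * a i)) • u k * b i = u k * v k * x := by
      conv_rhs => rw [mul_assoc, ← sum_smul_right (v k * x)]
      rw [Finset.mul_sum]
      refine Finset.sum_congr rfl fun i _ => ?_
      rw [mul_smul_comm, smul_mul_assoc, mul_assoc]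
    simp only [hE, Finset.sum_mul]
    rw [Finset.sum_comm]
    simp only [contract, ← Finset.sum_mul, huv, one_mul]
  · refine sub_eq_zero.1 (H.faithful.nondegenerate _ fun x => ?_)
    rw [sub_mul, map_sub, sub_eq_zero, ← H.regTrace_eq, regTrace_apply, trace_eq, Finset.sum_mul,
      map_sum]
    refine Finset.sum_congr rfl fun i _ => ?_
    rw [trace, LinearMap.mulLeft_apply, mul_assoc x, trace, mul_assoc]

lemma cornerDim_one_left (H : IsRegularCondExp B h E K) {g : A} (hg : g ∈ B) (hgg : g * g = g) :
    (cornerDim B 1 g : ℂ) = h g := by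
  obtain ⟨m, u, v, hE, hvu, -⟩ := H.exists_casimir
  rw [cornerDim_eq_trace H.isStarSubalgebra H.condExp.isProj H.isStarSubalgebra.one_mem hg
    (one_mul 1) hgg, LinearMap.mulLeft_one, LinearMap.id_comp, trace_comp_eq_sum hE]
  simp only [LinearMap.mulRight_apply, ← mul_assoc, ← map_sum, ← Finset.sum_mul, hvu, one_mul]

lemma finrank_map (H : IsRegularCondExp B h E K) {g : A} (hg : g ∈ B) (hgg : g * g = g) :
    (Module.finrank ℂ (B.map (LinearMap.mulLeft ℂ g)) : ℂ) = h g := by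
  obtain ⟨m, u, v, hE, -, huv⟩ := H.exists_casimir
  have hdim := cornerDim_eq_trace H.isStarSubalgebra H.condExp.isProj hg
    H.isStarSubalgebra.one_mem hgg (one_mul 1)
  rw [cornerDim, LinearMap.mulRight_one, LinearMap.comp_id, LinearMap.id_comp,
    trace_comp_eq_sum hE] at hdim
  simp only [hdim, LinearMap.mulLeft_apply, ← mul_assoc, H.faithful.trace _ (u _)]
  rw [← map_sum, ← Finset.sum_mul, huv, one_mul]

lemma sum_inclusionMult_mul (H : IsRegularCondExp B h E K) {m : ℕ} {f : Fin m → A}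
    (hf : IsSectorSystem B f) {e : A} (he : e * e = e) {b : A} (hb : b ∈ B)
    (hbc : ∀ x ∈ B, b * x = x * b) :
    ∑ j, (inclusionMult e (f j) : ℂ) * h (b * f j) = bimodTrace ℂ b e := by
  have summand (j) : (inclusionMult e (f j) : ℂ) * h (b * f j) =
      (cornerDim B 1 (f j) : ℂ) * bimodTrace ℂ (b * f j) e := by
    obtain ⟨c, hc⟩ := (hf.minimal j).exists_mul_eq_smul H.isStarSubalgebra hb
      (hbc _ (hf.minimal j).mem)
    rw [H.cornerDim_one_left (hf.minimal j).mem (hf.minimal j).mul_self, hc,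
      inclusionMult_eq_bimodTrace (hf.minimal j).mul_self he, map_smul, map_smul,
      LinearMap.smul_apply, smul_eq_mul, smul_eq_mul]
    ring
  have trace_mul (x) (_ : x ∈ B) (y) (hy : y ∈ B) :
      bimodTrace ℂ (b * (x * y)) e = bimodTrace ℂ (b * (y * x)) e := by
    rw [← mul_assoc, bimodTrace_mul_comm_left, ← mul_assoc, ← hbc y hy, mul_assoc]
  calc ∑ j, (inclusionMult e (f j) : ℂ) * h (b * f j)
      = ∑ j, (cornerDim B 1 (f j) : ℂ) * bimodTrace ℂ (b * f j) e :=
        Finset.sum_congr rfl fun j _ => summand j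
    _ = bimodTrace ℂ (b * 1) e :=
        hf.sum_cornerDim_mul H.isStarSubalgebra
          (σ := (bimodTrace ℂ).flip e ∘ₗ LinearMap.mulLeft ℂ b) trace_mul
          H.isStarSubalgebra.one_mem (.one A)
    _ = bimodTrace ℂ b e := by rw [mul_one]

theorem sum_inclusionMult_mul_transpose (H : IsRegularCondExp B h E K) {n m : ℕ} {e : Fin n → A}
    {f : Fin m → A} (he : IsSectorSystem (⊤ : Submodule ℂ A) e) (hf : IsSectorSystem B f) {k : A}
    (hk : ∀ x, k * x = x * k) (i : Fin n) :
    ∑ i', (∑ j, (inclusionMult (e i) (f j) : ℂ) * (inclusionMult (e i') (f j) : ℂ)) * h (k * e i') =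
      bimodTrace ℂ (E k) (e i) := by
  have sum_eq (j) : ∑ i', (inclusionMult (e i') (f j) : ℂ) * h (k * e i') = h (E k * f j) := by
    rw [H.apply_map_mul (hf.minimal j).mem]
    exact he.sum_inclusionMult_mul (σ := h ∘ₗ LinearMap.mulLeft ℂ k)
      (apply_central_mul_mul_comm H.faithful.trace hk) (hf.minimal j).isStarProjection
  rw [← H.sum_inclusionMult_mul hf (he.minimal i).mul_self (H.condExp.mem k)
    fun b hb => H.map_comm hk hb]
  simp only [← sum_eq, Finset.mul_sum, Finset.sum_mul, mul_assoc]
  exact Finset.sum_comm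

lemma sum_inclusionMult_mul_transpose_of_mem (H : IsRegularCondExp B h E K) {n m : ℕ}
    {e : Fin n → A} {f : Fin m → A} (he : IsSectorSystem (⊤ : Submodule ℂ A) e)
    (hf : IsSectorSystem B f) {k : A} (hkB : k ∈ B) (hk : ∀ x, k * x = x * k) (i : Fin n) :
    ∑ i', (∑ j, (inclusionMult (e i) (f j) : ℂ) * (inclusionMult (e i') (f j) : ℂ)) * h (k * e i') =
      h (K * (k * e i)) := by
  rw [H.sum_inclusionMult_mul_transpose he hf hk, H.condExp.apply_of_mem k hkB,
    bimodTrace_of_central_left H.faithful.nondegenerate H.faithful.trace hk, H.regTrace_eq]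

lemma exists_index_mul_eq_smul (H : IsRegularCondExp B h E K) {z : A}
    (hz : IsMinProj (B ⊓ Subalgebra.toSubmodule (Subalgebra.center ℂ A)) z) :
    ∃ c : ℂ, K * z = c • z :=
  hz.exists_mul_eq_smul (H.isStarSubalgebra.inf .center)
    ⟨H.index_mem, mem_center_iff.2 H.index_comm⟩ (H.index_comm z)

lemma isMarkovTraceFor (H : IsRegularCondExp B h E K) {k : A} (hk : k ∈ B)
    (hkc : ∀ x, k * x = x * k) {τ : A →ₗ[ℂ] ℂ} (hτ : IsFaithfulTrace τ)
    (hτk : ∀ x, τ x = h (k * x)) : IsMarkovTraceFor B τ := by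
  refine ⟨hτ, fun n m e f he hf z hz => ?_⟩
  obtain ⟨c, hc⟩ := H.exists_index_mul_eq_smul hz
  refine ⟨c, fun i hi => ?_⟩
  simp only [hτk]
  rw [H.sum_inclusionMult_mul_transpose_of_mem he hf hk hkc, ← hi, ← mul_assoc, ← mul_assoc,
    H.index_comm, mul_assoc k, hc, mul_smul_comm, smul_mul_assoc, map_smul, smul_eq_mul, mul_assoc]

section Projection

variable {z : A} {r : ℂ}

-- The integral matrix `Λ Λᵗ` has the eigenvalue `r` on the vector `h(z eᵢ)`.
lemma isIntegral_index (H : IsRegularCondExp B h E K) (hz : z ∈ B) (hzc : ∀ x, z * x = x * z)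
    (hzp : IsStarProjection z) (hz0 : z ≠ 0) (hr : K * z = r • z) : IsIntegral ℤ r := by
  obtain ⟨n, e, he⟩ := exists_isSectorSystem (A := A) .top
  obtain ⟨m, f, hf⟩ := exists_isSectorSystem H.isStarSubalgebra
  let N : Submodule ℤ ℂ := Submodule.span ℤ (Set.range fun i => h (z * e i))
  have ne_bot : N ≠ ⊥ := by
    obtain ⟨i, x, hx⟩ := he.exists_mul_ne_zero hzp hz0
    have hzei : z * e i ≠ 0 := fun h => hx (by rw [hzc, mul_assoc, h, mul_zero])
    have hpos : 0 < h (z * e i) := H.faithful.pos_of_isStarProjection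
      (hzp.mul (he.minimal i).isStarProjection (hzc _)) hzei
    exact N.ne_bot_iff.2 ⟨_, Submodule.subset_span ⟨i, rfl⟩, hpos.ne'⟩
  have fg : N.FG := Submodule.fg_span (Set.finite_range _)
  refine isIntegral_of_smul_mem_submodule N ne_bot fg r fun y hy => ?_
  induction hy using Submodule.span_induction with
  | mem y hy =>
    obtain ⟨i, rfl⟩ := hy
    have eigen := H.sum_inclusionMult_mul_transpose_of_mem he hf hz hzc i
    rw [← mul_assoc, hr, smul_mul_assoc, map_smul] at eigen
    rw [← eigen]
    refine Submodule.sum_mem _ fun i' _ => ?_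
    simpa using N.smul_mem
      (∑ j, (inclusionMult (e i) (f j) : ℤ) * (inclusionMult (e i') (f j) : ℤ))
      (Submodule.subset_span ⟨i', rfl⟩)
  | zero => simp
  | add x y _ _ hx hy => rw [smul_add]; exact N.add_mem hx hy
  | smul c x _ hx => rw [smul_comm]; exact N.smul_mem c hx

lemma finrank_map_ne_zero (H : IsRegularCondExp B h E K) (hz : z ∈ B) (hzp : IsStarProjection z)
    (hz0 : z ≠ 0) : Module.finrank ℂ (B.map (LinearMap.mulLeft ℂ z)) ≠ 0 := by
  rw [← Nat.cast_ne_zero (R := ℂ), H.finrank_map hz hzp.isIdempotentElem]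
  exact (H.faithful.pos_of_isStarProjection hzp hz0).ne'

lemma finrank_range_mulLeft_eq_mul (H : IsRegularCondExp B h E K) (hz : z ∈ B) (hzz : z * z = z)
    (hr : K * z = r • z) : (Module.finrank ℂ (LinearMap.range (LinearMap.mulLeft ℂ z)) : ℂ) =
      r * Module.finrank ℂ (B.map (LinearMap.mulLeft ℂ z)) := by
  rw [H.finrank_map hz hzz, finrank_range_mulLeft hzz, H.regTrace_eq, hr, map_smul, smul_eq_mul]

theorem exists_index_eq_natCast (H : IsRegularCondExp B h E K) (hz : z ∈ B)
    (hzc : ∀ x, z * x = x * z) (hzp : IsStarProjection z) (hz0 : z ≠ 0) (hr : K * z = r • z) :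
    ∃ k : ℕ, r = k :=
  exists_natCast_eq_of_isIntegral (H.isIntegral_index hz hzc hzp hz0 hr)
    (H.finrank_map_ne_zero hz hzp hz0)
    (H.finrank_range_mulLeft_eq_mul hz hzp.isIdempotentElem hr).symm

end Projection

end IsRegularCondExp

end CStar

section Markov

/-! ### Uniqueness of the Markov trace up to a hypercentral density -/

variable {A : Type*} [CStarAlgebra A]

lemma IsFaithfulTrace.apply_star_mul_self_nonneg {τ : A →ₗ[ℂ] ℂ} (hτ : IsFaithfulTrace τ) (x : A) :
    0 ≤ τ (star x * x) := by
  rcases eq_or_ne x 0 with rfl | hx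
  · simp
  · exact (hτ.faithful x hx).le

lemma IsFaithfulTrace.apply_mul_star_mul_self {τ : A →ₗ[ℂ] ℂ} (hτ : IsFaithfulTrace τ) {p : A}
    (hp : IsStarProjection p) (x : A) :
    τ (p * (star x * x)) = τ (star (x * p) * (x * p)) := by
  rw [star_mul, hp.isSelfAdjoint.star_eq]
  conv_lhs => rw [← hp.isIdempotentElem.eq, mul_assoc, hτ.trace]
  simp only [mul_assoc]

lemma IsMinProj.eq_of_mul_ne_zero {C : Submodule ℂ A} (hC : IsStarSubalgebra C) {p q : A}
    (hp : IsMinProj C p) (hq : IsMinProj C q) (hc : Commute p q) (h0 : p * q ≠ 0) : p = q := by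
  have hpq := (hq.mul_eq_zero_or_mul_eq hp.isStarProjection
    (hC.mul_mem _ hp.mem _ hq.mem) hc).resolve_left h0
  have hqp := (hp.mul_eq_zero_or_mul_eq hq.isStarProjection
    (hC.mul_mem _ hq.mem _ hp.mem) hc.symm).resolve_left (hc.eq ▸ h0)
  rw [← hqp, ← hc.eq, hpq]

variable [FiniteDimensional ℂ A]

lemma IsFaithfulTrace.exists_density {h τ : A →ₗ[ℂ] ℂ} (hh : IsFaithfulTrace h)
    (hτ : IsFaithfulTrace τ) :
    ∃ k : A, IsSelfAdjoint k ∧ (∀ x, k * x = x * k) ∧ ∀ x, τ x = h (k * x) := by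
  obtain ⟨n, a, b, sum_smul_left, -⟩ := exists_dual_bases hh.nondegenerate
  let k := ∑ i, τ (a i) • b i
  have density (x : A) : τ x = h (k * x) := by
    conv_lhs => rw [← sum_smul_left x]
    simp [k, Finset.sum_mul, mul_comm]
  refine ⟨k, ?_, fun x => ?_, density⟩
  · rw [IsSelfAdjoint, ← sub_eq_zero]
    refine hh.nondegenerate _ fun y => ?_
    have : star k * y = star (star y * k) := by rw [star_mul, star_star]
    rw [sub_mul, map_sub, sub_eq_zero, this, hh.map_star, hh.trace, ← density, ← density,
      hτ.map_star, star_star]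
  · rw [← sub_eq_zero]
    refine hh.nondegenerate _ fun y => ?_
    rw [sub_mul, map_sub, sub_eq_zero, mul_assoc, ← density, hτ.trace, density, mul_assoc x k,
      hh.trace x, mul_assoc]

lemma IsSectorSystem.apply_eq_of_central {n : ℕ} {e : Fin n → A}
    (he : IsSectorSystem (⊤ : Submodule ℂ A) e) {σ ρ : A →ₗ[ℂ] ℂ}
    (hσ : ∀ a b, σ (a * b) = σ (b * a)) (hρ : ∀ a b, ρ (a * b) = ρ (b * a))
    (heq : ∀ i, σ (e i) = ρ (e i)) {x : A} (hx : ∀ a, x * a = a * x) : σ x = ρ x := by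
  have expand {φ : A →ₗ[ℂ] ℂ} (hφ : ∀ a b, φ (a * b) = φ (b * a)) :
      ∑ i, (inclusionMult (e i) 1 : ℂ) * φ (x * e i) = φ x := by
    simpa using he.sum_inclusionMult_mul (σ := φ ∘ₗ LinearMap.mulLeft ℂ x)
      (apply_central_mul_mul_comm hφ hx) (.one A)
  rw [← expand hσ, ← expand hρ]
  refine Finset.sum_congr rfl fun i _ => ?_
  obtain ⟨c, hc⟩ := (he.minimal i).exists_mul_eq_smul .top (b := x) trivial (hx _)
  rw [hc, map_smul, map_smul, heq]

namespace IsRegularCondExp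

variable {B : Submodule ℂ A} {h τ : A →ₗ[ℂ] ℂ} {E : A →ₗ[ℂ] A} {K k z : A}

lemma exists_apply_index_mul_eq (H : IsRegularCondExp B h E K) (hτ : IsMarkovTraceFor B τ)
    (hk : ∀ x, k * x = x * k) (hτk : ∀ x, τ x = h (k * x))
    (hz : IsMinProj (B ⊓ Subalgebra.toSubmodule (Subalgebra.center ℂ A)) z) :
    ∃ r : ℂ, ∀ x, (∀ a, x * a = a * x) → h (K * (E k * (z * x))) = r * h (k * (z * x)) := by
  obtain ⟨n, e, he⟩ := exists_isSectorSystem (A := A) .top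
  obtain ⟨m, f, hf⟩ := exists_isSectorSystem H.isStarSubalgebra
  obtain ⟨r, hr⟩ := hτ.perron_frobenius n m e f he hf z hz
  have hzc : ∀ x, z * x = x * z := mem_center_iff.1 hz.mem.2
  have eigen (i) : bimodTrace ℂ (E k) (z * e i) = r * h (k * (z * e i)) := by
    rcases (he.minimal i).mul_eq_zero_or_mul_eq hz.isStarProjection trivial (hzc _) with h0 | h1
    · simp [h0]
    · rw [h1, ← hτk, ← hr i h1]
      simp only [hτk]
      rw [H.sum_inclusionMult_mul_transpose he hf hk]
  refine ⟨r, fun x hx => ?_⟩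
  have hzx (a : A) : z * x * a = a * (z * x) := by rw [mul_assoc, hx, ← mul_assoc, hzc, mul_assoc]
  rw [← H.regTrace_eq, ← bimodTrace_of_central_right _ hzx]
  exact he.apply_eq_of_central (σ := bimodTrace ℂ (E k) ∘ₗ LinearMap.mulLeft ℂ z)
    (ρ := r • h ∘ₗ LinearMap.mulLeft ℂ k ∘ₗ LinearMap.mulLeft ℂ z)
    (apply_central_mul_mul_comm (bimodTrace_mul_comm_right _) hzc)
    (fun a b => congrArg (r * ·)
      (apply_central_mul_mul_comm (t := h ∘ₗ LinearMap.mulLeft ℂ k)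
        (apply_central_mul_mul_comm H.faithful.trace hk) hzc a b))
    eigen hx

-- Cauchy–Schwarz replaces the uniqueness of Perron–Frobenius vectors: testing the eigenvalue
-- equation against `1` and `k` gives `h(z E(k) k) = h(z k²)`, hence `h(z |k - E(k)|²) = 0`.
lemma map_density_mul (H : IsRegularCondExp B h E K) (hτ : IsMarkovTraceFor B τ)
    (hksa : IsSelfAdjoint k) (hk : ∀ x, k * x = x * k) (hτk : ∀ x, τ x = h (k * x))
    (hz : IsMinProj (B ⊓ Subalgebra.toSubmodule (Subalgebra.center ℂ A)) z) :
    k * z = E k * z := by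
  obtain ⟨κ, hκ⟩ := H.exists_index_mul_eq_smul hz
  obtain ⟨r, hr⟩ := H.exists_apply_index_mul_eq hτ hk hτk hz
  have hzc : ∀ x, z * x = x * z := mem_center_iff.1 hz.mem.2
  have hκr (x : A) (hx : ∀ a, x * a = a * x) : κ * h (E k * z * x) = r * h (k * z * x) := by
    rw [mul_assoc k, ← hr x hx, ← hzc, mul_assoc, ← smul_eq_mul, ← map_smul, ← smul_mul_assoc, ← hκ]
    simp only [mul_assoc]
    rw [← mul_assoc z, hzc, mul_assoc]
  have apply_map (b : A) (hb : b ∈ B) : h (E k * b) = h (k * b) := H.apply_map_mul hb k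
  have κ_ne_zero : κ ≠ 0 := by
    rintro rfl
    have : χ z ≠ 0 :=
      (isFaithfulTrace_regTrace.pos_of_isStarProjection hz.isStarProjection hz.ne_zero).ne'
    rw [H.regTrace_eq, hκ, zero_smul, map_zero] at this
    exact this rfl
  have r_eq : r = κ := by
    have hpos : 0 < h (k * z) :=
      hτk z ▸ hτ.isFaithfulTrace.pos_of_isStarProjection hz.isStarProjection hz.ne_zero
    have := hκr 1 (by simp)
    rw [mul_one, mul_one, apply_map z hz.mem.1] at this
    exact (mul_right_cancel₀ hpos.ne' this).symm
  have cross_term : h (k * z * (k - E k)) = 0 := by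
    have := mul_left_cancel₀ κ_ne_zero (r_eq ▸ hκr k hk)
    rw [mul_sub, map_sub, ← this, H.faithful.trace _ (E k), mul_assoc, hzc, sub_self]
  have orthogonal : h (star (E k) * z * (k - E k)) = 0 := by
    have hb : star (E k) * z ∈ B := H.isStarSubalgebra.mul_mem _
      (H.isStarSubalgebra.star_mem _ (H.condExp.mem k)) _ hz.mem.1
    rw [H.faithful.trace, sub_mul, map_sub, apply_map _ hb, sub_self]
  rw [← sub_eq_zero, ← sub_mul]
  by_contra hne
  refine (H.faithful.faithful _ hne).ne' ?_
  have : star ((k - E k) * z) * ((k - E k) * z) =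
      k * z * (k - E k) - star (E k) * z * (k - E k) := by
    rw [← hzc, star_mul, star_sub, hksa.star_eq, hz.isSelfAdjoint.star_eq, mul_assoc, ← mul_assoc z,
      hz.mul_self, ← mul_assoc, sub_mul _ _ z, sub_mul]
  rw [this, map_sub, cross_term, orthogonal, sub_zero]

theorem density_mem (H : IsRegularCondExp B h E K) (hτ : IsMarkovTraceFor B τ)
    (hksa : IsSelfAdjoint k) (hk : ∀ x, k * x = x * k) (hτk : ∀ x, τ x = h (k * x)) : k ∈ B := by
  have mul_eq : k * 1 = E k * 1 :=
    starProjection_induction (B := B ⊓ Subalgebra.toSubmodule (Subalgebra.center ℂ A))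
      (P := fun g => k * g = E k * g) (by simp)
      (fun a _ p _ _ _ ha hp => by rw [mul_add, ha, hp, ← mul_add])
      (fun z hz => H.map_density_mul hτ hksa hk hτk hz)
      (H.isStarSubalgebra.inf .center).one_mem (.one A)
  rw [← mul_one k, mul_eq, mul_one]
  exact H.condExp.mem k

theorem isPreservingCondExp_of_isMarkovTraceFor (H : IsRegularCondExp B h E K)
    (hτ : IsMarkovTraceFor B τ) : IsPreservingCondExp B τ E := by
  obtain ⟨k, hksa, hk, hτk⟩ := H.faithful.exists_density hτ.isFaithfulTrace
  exact H.isPreservingCondExp (H.density_mem hτ hksa hk hτk) hτk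

end IsRegularCondExp

section CentralSubalgebra

variable {C : Submodule ℂ A}

lemma exists_mem_mul_eq_smul (hC : IsStarSubalgebra C) (hCc : ∀ x ∈ C, ∀ y, x * y = y * x)
    (c : A → ℂ) : ∃ k ∈ C, ∀ p, IsMinProj C p → k * p = c p • p := by
  obtain ⟨n, f, hf⟩ := exists_isSectorSystem hC
  refine ⟨∑ j, c (f j) • f j, C.sum_mem fun j _ => C.smul_mem _ (hf.minimal j).mem,
    fun p hp => ?_⟩
  obtain ⟨i, x, -, hx⟩ := hf.exhaustive p hp
  obtain rfl : p = f i := hp.eq_of_mul_ne_zero hC (hf.minimal i) (hCc _ hp.mem _) fun h0 => hx (by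
    rw [hCc p hp.mem, mul_assoc, h0, mul_zero])
  rw [Finset.sum_mul, Finset.sum_eq_single i]
  · rw [smul_mul_assoc, (hf.minimal i).mul_self]
  · intro j _ hji
    have := hf.inequivalent j i hji 1 hC.one_mem
    rw [smul_mul_assoc, ← mul_one (f j), this, smul_zero]
  · simp

lemma eq_zero_of_forall_isMinProj_mul (hC : IsStarSubalgebra C) {x : A}
    (hx : ∀ p, IsMinProj C p → p * x = 0) : x = 0 := by
  rw [← one_mul x]
  exact starProjection_induction (B := C) (P := fun g => g * x = 0) (zero_mul x)
    (fun a _ p _ _ _ ha hp => by rw [add_mul, ha, hp, add_zero]) hx hC.one_mem (.one A)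

lemma IsFaithfulTrace.comp_mulLeft {h : A →ₗ[ℂ] ℂ} (hh : IsFaithfulTrace h)
    (hC : IsStarSubalgebra C) {k : A} (hk : ∀ x, k * x = x * k)
    {c : A → ℂ} (hc : ∀ p, IsMinProj C p → 0 < c p) (hkc : ∀ p, IsMinProj C p → k * p = c p • p) :
    IsFaithfulTrace (h ∘ₗ LinearMap.mulLeft ℂ k) := by
  refine ⟨fun x y => ?_, fun x hx => ?_⟩
  · simp only [LinearMap.comp_apply, LinearMap.mulLeft_apply]
    rw [← mul_assoc, hk, mul_assoc, hh.trace, mul_assoc]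
  have apply_minimal (p) (hp : IsMinProj C p) : h (k * (p * (star x * x))) =
      c p * h (star (x * p) * (x * p)) := by
    rw [← mul_assoc, hkc p hp, smul_mul_assoc, map_smul, smul_eq_mul,
      hh.apply_mul_star_mul_self hp.isStarProjection]
  have nonneg {g : A} (hg : g ∈ C) (hgp : IsStarProjection g) : 0 ≤ h (k * (g * (star x * x))) := by
    refine starProjection_induction (B := C) (P := fun g => 0 ≤ h (k * (g * (star x * x))))
      (by simp) (fun a _ p _ _ _ ha hp => ?_) (fun p hp => ?_) hg hgp
    · rw [add_mul, mul_add, map_add]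
      exact add_nonneg ha hp
    · rw [apply_minimal p hp]
      exact mul_nonneg (hc p hp).le (hh.apply_star_mul_self_nonneg _)
  obtain ⟨p, hp, hxp⟩ : ∃ p, IsMinProj C p ∧ x * p ≠ 0 := by
    by_contra! h0
    refine hx (star_eq_zero.1 (eq_zero_of_forall_isMinProj_mul hC fun p hp => ?_))
    rw [← hp.isSelfAdjoint.star_eq, ← star_mul, h0 p hp, star_zero]
  have split : star x * x = p * (star x * x) + (1 - p) * (star x * x) := by
    rw [sub_mul, one_mul, add_sub_cancel]
  rw [LinearMap.comp_apply, LinearMap.mulLeft_apply, split, mul_add, map_add]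
  refine add_pos_of_pos_of_nonneg ?_
    (nonneg (C.sub_mem hC.one_mem hp.mem) hp.isStarProjection.one_sub)
  rw [apply_minimal p hp]
  exact mul_pos (hc p hp) (hh.faithful _ hxp)

lemma IsFaithfulTrace.exists_normalized {h : A →ₗ[ℂ] ℂ} (hh : IsFaithfulTrace h)
    (hC : IsStarSubalgebra C) (hCc : ∀ x ∈ C, ∀ y, x * y = y * x) :
    ∃ k ∈ C, IsFaithfulTrace (h ∘ₗ LinearMap.mulLeft ℂ k) ∧
      ∀ p, IsMinProj C p → h (k * p) = 1 := by
  have pos (p) (hp : IsMinProj C p) : 0 < h p :=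
    hh.pos_of_isStarProjection hp.isStarProjection hp.ne_zero
  obtain ⟨k, hk, hkp⟩ := exists_mem_mul_eq_smul hC hCc fun p => (h p)⁻¹
  refine ⟨k, hk, hh.comp_mulLeft hC (hCc k hk) (fun p hp => inv_pos.2 (pos p hp)) hkp,
    fun p hp => ?_⟩
  rw [hkp p hp, map_smul, smul_eq_mul, inv_mul_cancel₀ (pos p hp).ne']

end CentralSubalgebra

end Markov

section CondExp

variable {A : Type*} [CStarAlgebra A] {B : Submodule ℂ A} {h : A →ₗ[ℂ] ℂ}

lemma IsFaithfulTrace.eq_of_forall_apply_mul_eq (hh : IsFaithfulTrace h) (hB : IsStarSubalgebra B)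
    {x y : A} (hx : x ∈ B) (hy : y ∈ B) (hxy : ∀ b ∈ B, h (b * x) = h (b * y)) : x = y := by
  rw [← sub_eq_zero]
  by_contra hne
  refine (hh.faithful _ hne).ne' ?_
  rw [mul_sub, map_sub, sub_eq_zero]
  exact hxy _ (hB.star_mem _ (B.sub_mem hx hy))

section Preserving

variable {E : A →ₗ[ℂ] A} (hh : IsFaithfulTrace h) (hB : IsStarSubalgebra B) (hE : ∀ x, E x ∈ B)
  (hpres : ∀ b ∈ B, ∀ x, h (b * E x) = h (b * x))
include hh hB hE hpres

lemma IsFaithfulTrace.map_star_of_preserving (x : A) : E (star x) = star (E x) := by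
  refine hh.eq_of_forall_apply_mul_eq hB (hE _) (hB.star_mem _ (hE x)) fun b hb => ?_
  have apply_mul_star (y : A) : h (b * star y) = star (h (star b * y)) := by
    rw [← hh.map_star, star_mul, star_star, hh.trace]
  rw [hpres b hb, apply_mul_star, apply_mul_star, hpres _ (hB.star_mem b hb)]

variable [FiniteDimensional ℂ A]

-- An eigenvalue `c` of `E (x* x)` satisfies `c h(q) = h((x q)* (x q))` for its spectral projection
-- `q ∈ B`.
lemma IsFaithfulTrace.exists_map_star_mul_self_eq (x : A) : ∃ y, E (star x * x) = star y * y := by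
  have selfAdjoint : IsSelfAdjoint (E (star x * x)) := by
    rw [IsSelfAdjoint, ← hh.map_star_of_preserving hB hE hpres, star_mul, star_star]
  let _ := CStarAlgebra.spectralOrder A
  have _ := CStarAlgebra.spectralOrderedRing A
  suffices 0 ≤ E (star x * x) from CStarAlgebra.nonneg_iff_eq_star_mul_self.1 this
  rw [StarOrderedRing.nonneg_iff_spectrum_nonneg (R := ℂ) _ selfAdjoint.isStarNormal]
  intro c hc
  obtain ⟨y, hy, hEy⟩ := mem_spectrum_iff_exists_mul_eq_smul.1 hc
  obtain ⟨q, hq, hqp, hqx⟩ := exists_spectral_projection hB (hE _) selfAdjoint c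
  have q_ne_zero : q ≠ 0 := by
    rintro rfl
    exact hy (by rw [← (hqx y).2 hEy, zero_mul])
  have apply_q : h (star (x * q) * (x * q)) = c * h q := by
    rw [← hh.apply_mul_star_mul_self hqp, ← hpres q hq, hh.trace,
      (hqx q).1 hqp.isIdempotentElem, map_smul, smul_eq_mul]
  refine le_of_mul_le_mul_right ?_ (hh.pos_of_isStarProjection hqp q_ne_zero)
  rw [zero_mul, ← apply_q]
  exact hh.apply_star_mul_self_nonneg _

theorem IsFaithfulTrace.isCondExp : IsCondExp B E where
  mem := hE
  apply_of_mem b hb := hh.eq_of_forall_apply_mul_eq hB (hE b) hb fun c hc => hpres c hc b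
  bimodule b hb c hc x := by
    refine hh.eq_of_forall_apply_mul_eq hB (hE _)
      (hB.mul_mem _ (hB.mul_mem _ hb _ (hE x)) _ hc) fun d hd => ?_
    have hcdb : c * d * b ∈ B := hB.mul_mem _ (hB.mul_mem _ hc _ hd) _ hb
    calc h (d * E (b * x * c)) = h (d * b * x * c) := by rw [hpres d hd]; simp only [mul_assoc]
      _ = h (c * d * b * x) := by rw [hh.trace]; simp only [mul_assoc]
      _ = h (c * d * b * E x) := (hpres _ hcdb x).symm
      _ = h (d * (b * E x * c)) := by rw [mul_assoc c, mul_assoc c, hh.trace]; simp only [mul_assoc]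
  positive := hh.exists_map_star_mul_self_eq hB hE hpres

end Preserving

end CondExp

section Haar

/-! ### The Haar functional -/

section WeakHopf

variable {A : Type*} [Ring A] [Algebra ℂ A] [Coalgebra ℂ A]

variable (A) in
/-- The regular trace divided by `haarIndex`; it is the Haar functional of a weak Kac algebra. -/
def haarFunctional : Module.Dual ℂ A := χ ∘ₗ LinearMap.mulLeft ℂ (Ring.inverse haarIndex)

lemma haarFunctional_apply (x : A) : haarFunctional A x = χ (Ring.inverse haarIndex * x) := rfl

variable [WeakHopfAlgebra A]

local notation "𝟙" => ℛ ℂ (1 : A)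

lemma haarEL_regTrace_of_mem_left {x : A} (hx : x ∈ leftSub A) : haarEL χ x = haarIndex * x := by
  rw [haarIndex, ← haarEL_mul_left _ hx, one_mul]

-- `χ(K p)` is the rank of the idempotent `Δ(1) (p ⊗ 1)` of `A ⊗ A`.
lemma exists_regTrace_haarIndex_mul_eq_natCast [FiniteDimensional ℂ A] {p : A} (hp : p * p = p)
    (hpc : ∀ x, p * x = x * p) : ∃ n : ℕ, χ (haarIndex * p) = n := by
  have regTrace_eq : χ (haarIndex * p) = regTrace ℂ (Δ (1 : A) * (p ⊗ₜ 1)) := by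
    rw [haarIndex, haarEL_apply 𝟙, ← 𝟙.eq]
    simp [Finset.sum_mul, regTrace_tmul, mul_comm]
  have commutes : (p ⊗ₜ 1) * Δ (1 : A) = Δ 1 * (p ⊗ₜ 1) := by
    rw [← 𝟙.eq]
    simp [Finset.sum_mul, Finset.mul_sum, hpc]
  refine ⟨_, regTrace_eq.trans (finrank_range_mulLeft ?_).symm⟩
  rw [mul_assoc, ← mul_assoc (p ⊗ₜ 1), commutes, mul_assoc, Algebra.TensorProduct.tmul_mul_tmul,
    hp, one_mul, ← mul_assoc, comul_one_mul_comul]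

end WeakHopf

variable {A : Type*} [CStarAlgebra A] [Coalgebra ℂ A] [WeakKacAlgebra A]

local notation "𝟙" => ℛ ℂ (1 : A)

instance : FiniteDimensional ℂ A := WeakKacAlgebra.finiteDimensional

lemma antipode_involutive : Function.Involutive (antipode : A →ₗ[ℂ] A) :=
  WeakKacAlgebra.antipode_antipode

lemma star_comul_one : star (Δ (1 : A)) = Δ 1 := by
  rw [← WeakKacAlgebra.comul_star, star_one]

lemma isStarSubalgebra_left : IsStarSubalgebra (leftSub A) where
  one_mem := one_mem_left
  mul_mem _ hx _ hy := mul_mem_left hx hy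
  star_mem x hx := mem_left_of_comul (by
    rw [WeakKacAlgebra.comul_star, comul_of_mem_left hx, star_mul, star_comul_one,
      TensorProduct.star_tmul, star_one])

lemma isStarSubalgebra_right : IsStarSubalgebra (rightSub A) where
  one_mem := one_mem_right
  mul_mem _ hx _ hy := mul_mem_right hx hy
  star_mem x hx := mem_right_of_comul (by
    rw [WeakKacAlgebra.comul_star, comul_of_mem_right hx, star_mul, star_comul_one,
      TensorProduct.star_tmul, star_one])

lemma isStarSubalgebra_hypercenter : IsStarSubalgebra (hypercenter A) :=
  (isStarSubalgebra_left.inf isStarSubalgebra_right).inf .center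

omit [WeakKacAlgebra A] in
lemma hypercenter_comm {x : A} (hx : x ∈ hypercenter A) (y : A) : x * y = y * x :=
  mem_center_iff.1 hx.2 y

lemma haarER_comp_antipode (φ : A →ₗ[ℂ] ℂ) (x : A) :
    haarER (φ ∘ₗ antipode) x = antipode (haarEL φ (antipode x)) := by
  simp only [haarEL, LinearMap.comp_apply, LinearEquiv.coe_coe]
  rw [comul_antipode, haarER_apply (ℛ ℂ x), ← (ℛ ℂ x).eq]
  simp [antipode_involutive _]

lemma exists_pos_haarIndex_mul_eq_smul {p : A} (hp : IsMinProj (hypercenter A) p) :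
    ∃ c : ℂ, 0 < c ∧ haarIndex * p = c • p := by
  obtain ⟨c, hc⟩ := hp.exists_mul_eq_smul isStarSubalgebra_hypercenter
    (haarIndex_mem antipode_involutive) (haarIndex_comm antipode_involutive p)
  have regTrace_pos : 0 < χ p :=
    isFaithfulTrace_regTrace.pos_of_isStarProjection hp.isStarProjection hp.ne_zero
  have c_nonneg : 0 ≤ c := by
    obtain ⟨n, hn⟩ := exists_regTrace_haarIndex_mul_eq_natCast hp.mul_self (hypercenter_comm hp.mem)
    rw [hc, map_smul, smul_eq_mul] at hn
    refine le_of_mul_le_mul_right ?_ regTrace_pos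
    rw [zero_mul, hn]
    exact Nat.cast_nonneg n
  refine ⟨c, c_nonneg.lt_of_ne' ?_, hc⟩
  rintro rfl
  refine regTrace_pos.ne' ?_
  rw [← counit_haarEL, haarEL_regTrace_of_mem_left hp.mem.1.1, hc, zero_smul, map_zero]

lemma exists_haarIndex_inv : ∃ k ∈ hypercenter A, k * haarIndex = 1 ∧
    IsFaithfulTrace (χ ∘ₗ LinearMap.mulLeft ℂ k : A →ₗ[ℂ] ℂ) := by
  have exists_eigenvalue (p : A) :
      ∃ c : ℂ, IsMinProj (hypercenter A) p → 0 < c ∧ haarIndex * p = c • p := by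
    by_cases hp : IsMinProj (hypercenter A) p
    · exact (exists_pos_haarIndex_mul_eq_smul hp).imp fun c hc _ => hc
    · exact ⟨0, fun h => absurd h hp⟩
  choose c hc using exists_eigenvalue
  obtain ⟨k, hk, hkp⟩ := exists_mem_mul_eq_smul isStarSubalgebra_hypercenter
    (fun x hx => hypercenter_comm hx) fun p => (c p)⁻¹
  refine ⟨k, hk, ?_, isFaithfulTrace_regTrace.comp_mulLeft isStarSubalgebra_hypercenter
    (hypercenter_comm hk) (fun p hp => inv_pos.2 (hc p hp).1) hkp⟩
  rw [← sub_eq_zero]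
  refine eq_zero_of_forall_isMinProj_mul isStarSubalgebra_hypercenter fun p hp => ?_
  rw [mul_sub, mul_one, ← mul_assoc, ← hypercenter_comm hk, hkp p hp, smul_mul_assoc,
    ← haarIndex_comm antipode_involutive, (hc p hp).2, smul_smul, inv_mul_cancel₀ (hc p hp).1.ne',
    one_smul, sub_self]

lemma inverse_haarIndex_eq {k : A} (hk : k * haarIndex = 1) : Ring.inverse haarIndex = k := by
  have hk' : haarIndex * k = 1 := by rw [haarIndex_comm antipode_involutive, hk]
  exact Ring.inverse_unit ⟨haarIndex, k, hk', hk⟩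

lemma inverse_haarIndex_mem : Ring.inverse (haarIndex : A) ∈ hypercenter A := by
  obtain ⟨k, hk, hkK, -⟩ := exists_haarIndex_inv (A := A)
  rwa [inverse_haarIndex_eq hkK]

lemma inverse_haarIndex_mul : Ring.inverse (haarIndex : A) * haarIndex = 1 := by
  obtain ⟨k, -, hkK, -⟩ := exists_haarIndex_inv (A := A)
  rwa [inverse_haarIndex_eq hkK]

lemma isFaithfulTrace_haarFunctional : IsFaithfulTrace (haarFunctional A) := by
  obtain ⟨k, -, hkK, hk⟩ := exists_haarIndex_inv (A := A)
  rwa [haarFunctional, inverse_haarIndex_eq hkK]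

lemma regTrace_eq_haarFunctional (x : A) : χ x = haarFunctional A (haarIndex * x) := by
  rw [haarFunctional_apply, ← mul_assoc, inverse_haarIndex_mul, one_mul]

lemma haarEL_haarFunctional (x : A) :
    haarEL (haarFunctional A) x = haarEL χ (Ring.inverse haarIndex * x) := by
  simp only [haarEL, LinearMap.comp_apply, LinearEquiv.coe_coe]
  rw [comul_mul, comul_of_mem_right' inverse_haarIndex_mem.1.2, mul_assoc, comul_one_mul_comul,
    ← (ℛ ℂ x).eq]
  simp [haarFunctional, Finset.mul_sum]

lemma haarEL_haarFunctional_mem (x : A) : haarEL (haarFunctional A) x ∈ leftSub A := by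
  rw [haarEL_haarFunctional]
  exact haarEL_regTrace_mem antipode_involutive _

lemma haarEL_haarFunctional_of_mem {x : A} (hx : x ∈ leftSub A) :
    haarEL (haarFunctional A) x = x := by
  have haarEL_one : haarEL (haarFunctional A) 1 = 1 := by
    rw [haarEL_haarFunctional, mul_one, haarEL_regTrace_of_mem_left inverse_haarIndex_mem.1.1,
      haarIndex_comm antipode_involutive, inverse_haarIndex_mul]
  rw [← mul_one x, haarEL_left_mul _ hx, haarEL_one]

lemma haarFunctional_of_mem_left {x : A} (hx : x ∈ leftSub A) : haarFunctional A x = ε x := by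
  rw [← counit_haarEL, haarEL_haarFunctional_of_mem hx]

lemma haarFunctional_haarEL (x : A) :
    haarFunctional A (haarEL (haarFunctional A) x) = haarFunctional A x := by
  rw [haarFunctional_of_mem_left (haarEL_haarFunctional_mem x), counit_haarEL]

lemma haarFunctional_antipode (x : A) : haarFunctional A (antipode x) = haarFunctional A x := by
  have antipode_inverse := antipode_of_mem (A := A) inverse_haarIndex_mem.1.1
    inverse_haarIndex_mem.1.2
  rw [haarFunctional_apply, ← antipode_inverse, ← antipode_mul_antidistrib,
    regTrace_antipode antipode_involutive isFaithfulTrace_regTrace.nondegenerate,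
    regTrace_mul_comm, haarFunctional_apply]

lemma haarER_haarFunctional (x : A) :
    haarER (haarFunctional A) x = antipode (haarEL (haarFunctional A) (antipode x)) := by
  rw [← haarER_comp_antipode]
  congr 2
  exact LinearMap.ext fun y => (haarFunctional_antipode y).symm

lemma haarER_haarFunctional_mem (x : A) : haarER (haarFunctional A) x ∈ rightSub A := by
  rw [haarER_haarFunctional]
  exact antipode_mem_right (haarEL_haarFunctional_mem _)

lemma haarFunctional_haarER (x : A) :
    haarFunctional A (haarER (haarFunctional A) x) = haarFunctional A x := by
  rw [haarER_haarFunctional, haarFunctional_antipode, haarFunctional_haarEL,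
    haarFunctional_antipode]

theorem isHaarFunctional_haarFunctional : IsHaarFunctional (haarFunctional A) where
  left_integral := dualMul_eq_of_haarEL_mem haarEL_haarFunctional_mem
  right_integral := dualMul_eq_of_haarER_mem haarER_haarFunctional_mem
  left_normalized := LinearMap.ext fun x => by
    rw [LinearMap.comp_apply, haarFunctional_of_mem_left (piL_mem x), counit_piL]
  right_normalized := LinearMap.ext fun x => by
    rw [LinearMap.comp_apply, ← haarFunctional_antipode,
      haarFunctional_of_mem_left (antipode_mem_left (piR_mem x)), antipode_of_mem_right (piR_mem x),
      counit_piL, counit_piR]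

-- By `haarEL_regTrace`, the elements `S(1₍₁₎)` and `1₍₂₎` are dual bases of `A^L`.
lemma exists_casimir_left : ∃ (n : ℕ) (u v : Fin n → A),
    (∀ x, haarEL (haarFunctional A) x = ∑ i, haarFunctional A (v i * x) • u i) ∧
      ∑ i, v i * u i = 1 ∧ ∑ i, u i * v i = 1 := by
  let e := (𝟙).index.equivFin
  have sum_equiv (f : A × A → A) : ∑ i, f (e.symm i) = ∑ i ∈ (𝟙).index, f i := by
    rw [← Finset.sum_coe_sort (𝟙).index f]
    exact e.symm.sum_comp (fun i => f i)
  refine ⟨_, fun i => antipode ((𝟙).left (e.symm i)), fun i => (𝟙).right (e.symm i), fun x => ?_,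
    ?_, ?_⟩
  · rw [haarEL_haarFunctional, haarEL_regTrace antipode_involutive, haarEL_apply 𝟙, map_sum,
      sum_equiv fun i => haarFunctional A ((𝟙).right i * x) • antipode ((𝟙).left i)]
    refine Finset.sum_congr rfl fun i _ => ?_
    rw [map_smul, LinearMap.comp_apply, LinearMap.mulLeft_apply, mul_assoc,
      ← haarFunctional_apply, isFaithfulTrace_haarFunctional.trace]
  · exact (sum_equiv fun i => (𝟙).right i * antipode ((𝟙).left i)).trans
      (sum_mul_antipode antipode_involutive)
  · exact (sum_equiv fun i => antipode ((𝟙).left i) * (𝟙).right i).trans sum_antipode_mul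

theorem isRegularCondExp_haarEL :
    IsRegularCondExp (leftSub A) (haarFunctional A) (haarEL (haarFunctional A)) haarIndex where
  isStarSubalgebra := isStarSubalgebra_left
  faithful := isFaithfulTrace_haarFunctional
  condExp := isFaithfulTrace_haarFunctional.isCondExp isStarSubalgebra_left
    haarEL_haarFunctional_mem fun b hb x => by
      rw [← haarEL_left_mul _ hb, haarFunctional_haarEL]
  map_exp := haarFunctional_haarEL
  exists_casimir := exists_casimir_left
  index_mem := haarIndex_mem_left antipode_involutive
  index_comm := haarIndex_comm antipode_involutive
  regTrace_eq := regTrace_eq_haarFunctional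

theorem isRegularCondExp_haarER :
    IsRegularCondExp (rightSub A) (haarFunctional A) (haarER (haarFunctional A)) haarIndex where
  isStarSubalgebra := isStarSubalgebra_right
  faithful := isFaithfulTrace_haarFunctional
  condExp := isFaithfulTrace_haarFunctional.isCondExp isStarSubalgebra_right
    haarER_haarFunctional_mem fun b hb x => by
      rw [haarER_haarFunctional, ← haarFunctional_antipode, antipode_mul_antidistrib,
        antipode_involutive, ← haarEL_mul_left _ (antipode_mem_left hb), haarFunctional_haarEL,
        ← antipode_mul_antidistrib, haarFunctional_antipode]
  map_exp := haarFunctional_haarER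
  exists_casimir := by
    obtain ⟨n, u, v, haarEL_eq, sum_mul, sum_mul'⟩ := exists_casimir_left (A := A)
    refine ⟨n, fun i => antipode (u i), fun i => antipode (v i), fun x => ?_, ?_, ?_⟩
    · rw [haarER_haarFunctional, haarEL_eq, map_sum]
      refine Finset.sum_congr rfl fun i _ => ?_
      rw [map_smul, ← haarFunctional_antipode, antipode_mul_antidistrib, antipode_involutive,
        isFaithfulTrace_haarFunctional.trace]
    · simp only [← antipode_mul_antidistrib, ← map_sum, sum_mul', antipode_one]
    · simp only [← antipode_mul_antidistrib, ← map_sum, sum_mul, antipode_one]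
  index_mem := haarIndex_mem_right
  index_comm := haarIndex_comm antipode_involutive
  regTrace_eq := regTrace_eq_haarFunctional

end Haar

section Vacuum

/-! ### Vacuum sectors -/

section WeakHopf

variable {A : Type*} [Ring A] [Algebra ℂ A]

lemma arrow_arrow (x y : A) (φ : Module.Dual ℂ A) : arrow x (arrow y φ) = arrow (x * y) φ := by
  ext; simp [arrow, mul_assoc]

variable [Coalgebra ℂ A]

lemma mem_trivialRep {φ : Module.Dual ℂ A} : φ ∈ trivialRep A ↔ ∃ x : A, arrow x ε = φ := Iff.rfl

lemma arrow_mem_trivialRep (x : A) {φ : Module.Dual ℂ A} (hφ : φ ∈ trivialRep A) :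
    arrow x φ ∈ trivialRep A := by
  obtain ⟨y, rfl⟩ := mem_trivialRep.1 hφ
  exact mem_trivialRep.2 ⟨x * y, (arrow_arrow x y ε).symm⟩

lemma counit_mem_trivialRep : (ε : Module.Dual ℂ A) ∈ trivialRep A :=
  mem_trivialRep.2 ⟨1, by ext; simp [arrow]⟩

lemma eq_zero_of_arrow_counit_eq_zero [WeakHopfAlgebra A] {x : A} (hx : x ∈ leftSub A)
    (h : arrow x (ε : Module.Dual ℂ A) = 0) : x = 0 := by
  have counit_mul (y : A) : ε (y * x) = 0 := LinearMap.congr_fun h y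
  rw [← piL_of_mem hx, piL_apply]
  simp [counit_mul]

lemma IsPure.eq_zero_or_eq_one [WeakHopfAlgebra A] (hA : IsPure A) {p : A} (hp : p ∈ zL A)
    (hpp : p * p = p) : p = 0 ∨ p = 1 := by
  have hpc := mem_center_iff.1 hp.2
  let W := (trivialRep A).map (LinearMap.mulRight ℂ p).dualMap
  have le_trivialRep : W ≤ trivialRep A := by
    rintro _ ⟨φ, hφ, rfl⟩
    exact arrow_mem_trivialRep p hφ
  have arrow_mem (x : A) (ψ) (hψ : ψ ∈ W) : arrow x ψ ∈ W := by
    obtain ⟨φ, hφ, rfl⟩ := hψ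
    refine ⟨arrow x φ, arrow_mem_trivialRep x hφ, ?_⟩
    exact (arrow_arrow p x φ).trans (hpc x ▸ (arrow_arrow x p φ).symm)
  refine (hA.2 W le_trivialRep arrow_mem).imp (fun hW => ?_) fun hW => ?_
  · refine eq_zero_of_arrow_counit_eq_zero hp.1 ((Submodule.mem_bot ℂ).1 ?_)
    exact hW ▸ Submodule.mem_map_of_mem counit_mem_trivialRep
  · obtain ⟨φ, -, hφ⟩ : ε ∈ W := hW ▸ counit_mem_trivialRep
    refine (sub_eq_zero.1 (eq_zero_of_arrow_counit_eq_zero (sub_mem one_mem_left hp.1) ?_)).symm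
    rw [← hφ]
    exact (arrow_arrow _ p φ).trans (by simp [sub_mul, hpp, arrow])

variable [WeakHopfAlgebra A]

lemma conv_mulRight_comp_piL_id (z x : A) : ((LinearMap.mulRight ℂ z ∘ₗ piL A) ⋆ .id) x =
    ((LinearMap.mulRight ℂ z ∘ₗ antipode) ⋆ .id) (1 : A) * x := by
  have conv_comp (f : A →ₗ[ℂ] A) (y : A) : ((LinearMap.mulRight ℂ z ∘ₗ f) ⋆ .id) y =
      LinearMap.mul' ℂ A
        (LinearMap.rTensor A (LinearMap.mulRight ℂ z) (LinearMap.rTensor A f (Δ y))) := by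
    rw [← LinearMap.rTensor_comp_apply]; rfl
  rw [conv_comp, conv_comp, rTensor_piL_comul, ← (ℛ ℂ (1 : A)).eq]
  simp [Finset.sum_mul, mul_assoc]

lemma conv_piL_id : piL A ⋆ .id = .id := by
  ext x
  have h := conv_mulRight_comp_piL_id 1 x
  rwa [LinearMap.mulRight_one, LinearMap.id_comp, LinearMap.id_comp, conv_antipode_id, piR_one,
    one_mul] at h

lemma conv_id_piR : .id ⋆ piR A = .id := by
  rw [← conv_antipode_id, ← conv_assoc, conv_id_antipode, conv_piL_id]

lemma piL_mul_of_mem {l : A} (hl : l ∈ leftSub A) (y : A) : piL A (l * y) = l * piL A y := by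
  have comul_eq : Δ (l * y) = (l ⊗ₜ 1) * Δ y := by
    rw [comul_mul, comul_of_mem_left hl, mul_assoc, comul_one_mul_comul]
  rw [← conv_id_antipode, conv_apply_of_comul_eq comul_eq, conv_apply, ← (ℛ ℂ y).eq]
  simp [Finset.mul_sum, mul_assoc]

section Central

variable {e : A} (he : ∀ x, e * x = x * e)
include he

lemma piL_mul_of_central (x : A) : piL A (x * e) = piL A x * piL A e := by
  rw [← he, ← piL_mul_piL, he, piL_mul_of_mem (piL_mem x)]

-- With `z = Π^L(e)`, one has `y z = y₍₁₎ z S(y₍₂₎) y₍₃₎ = Π^L(y₍₁₎) z y₍₂₎`, which is `w y` for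
-- `w = S(1₍₁₎) z 1₍₂₎`.
lemma piL_comm_of_central (x : A) : piL A e * x = x * piL A e := by
  set z := piL A e
  have conv_antipode : LinearMap.mulRight ℂ z ⋆ antipode = LinearMap.mulRight ℂ z ∘ₗ piL A := by
    ext y
    rw [conv_mulRight_piL_antipode, piL_mul_of_central he]; rfl
  have conv_piR : LinearMap.mulRight ℂ z ⋆ piR A = LinearMap.mulRight ℂ z := by
    have comm : LinearMap.mulLeft ℂ z ∘ₗ piR A = LinearMap.mulRight ℂ z ∘ₗ piR A :=
      LinearMap.ext fun y => (commute_piL_piR e y).eq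
    rw [← LinearMap.comp_id (LinearMap.mulRight ℂ z), mulRight_comp_conv, comm, conv_mulRight_comp,
      conv_id_piR]
  have mul_piL (y : A) :
      y * z = ((LinearMap.mulRight ℂ z ∘ₗ antipode) ⋆ .id) (1 : A) * y := by
    rw [← conv_mulRight_comp_piL_id, ← conv_antipode, conv_assoc, conv_antipode_id, conv_piR]; rfl
  rw [mul_piL x, ← mul_one (conv _ _ _), ← mul_piL 1, one_mul]

lemma arrow_piL_of_central {φ : Module.Dual ℂ A} (hφ : φ ∈ trivialRep A) :
    arrow (piL A e) φ = arrow e φ := by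
  obtain ⟨x, rfl⟩ := mem_trivialRep.1 hφ
  rw [arrow_arrow, arrow_arrow, piL_comm_of_central he, he]
  ext y
  simp only [arrow, LinearMap.comp_apply, LinearMap.mulRight_apply, ← mul_assoc, counit_mul_piL]

end Central

end WeakHopf

lemma isStarProjection_of_central {A : Type*} [CStarAlgebra A] {z : A} (hz : z * z = z)
    (hzc : ∀ x, z * x = x * z) : IsStarProjection z :=
  ⟨hz, (IsIdempotentElem.isSelfAdjoint_iff_isStarNormal hz).2 ⟨(hzc (star z)).symm⟩⟩

variable {A : Type*} [CStarAlgebra A] [Coalgebra ℂ A] [WeakKacAlgebra A]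

lemma IsVacuum.isLeftVacuumProj {e : A} (he : IsVacuum e) : IsLeftVacuumProj e (piL A e) := by
  obtain ⟨heMin, φ, hφ, hφ0⟩ := he
  have hec : ∀ x, e * x = x * e := mem_center_iff.1 heMin.mem
  have hzc := piL_comm_of_central hec
  have hzz : piL A e * piL A e = piL A e := by rw [← piL_mul_of_central hec, heMin.mul_self]
  have arrow_eq (ψ) (hψ : ψ ∈ trivialRep A) : arrow (piL A e) ψ = arrow e ψ :=
    arrow_piL_of_central hec hψ
  refine ⟨⟨⟨piL_mem e, mem_center_iff.2 hzc⟩, isStarProjection_of_central hzz hzc, fun hz0 => ?_,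
    fun q hq hqp hqz => ?_⟩, arrow_eq⟩
  · exact hφ0 (by rw [← arrow_eq φ hφ, hz0]; ext; simp [arrow])
  · have piL_mul : piL A (q * e) = q := by rw [piL_mul_of_mem hq.1, hqz]
    rw [← piL_mul]
    exact (heMin.mul_eq_zero_or_mul_eq hqp (IsStarSubalgebra.center.mul_mem _ hq.2 _ heMin.mem)
      (hec q).symm).imp (fun h => by rw [h, map_zero]) fun h => by rw [h]

lemma IsHyperSector.exists_haarIndex_mul_eq {H : A} (hH : IsHyperSector H) :
    ∃ k : ℕ, haarIndex * H = (k : ℂ) • H := by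
  obtain ⟨c, -, hc⟩ := exists_pos_haarIndex_mul_eq_smul hH
  obtain ⟨k, rfl⟩ := isRegularCondExp_haarEL.exists_index_eq_natCast hH.mem.1.1
    (hypercenter_comm hH.mem) hH.isStarProjection hH.ne_zero hc
  exact ⟨k, hc⟩

lemma finrank_range_mulLeft_eq_nat_mul {z : A} (hz : z ∈ leftSub A) (hzz : z * z = z) {k : ℕ}
    (hk : haarIndex * z = (k : ℂ) • z) :
    Module.finrank ℂ (LinearMap.range (LinearMap.mulLeft ℂ z)) =
      k * Module.finrank ℂ ((leftSub A).map (LinearMap.mulLeft ℂ z)) := by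
  exact_mod_cast isRegularCondExp_haarEL.finrank_range_mulLeft_eq_mul hz hzz hk

lemma exists_isMarkovTrace : ∃ τ : A →ₗ[ℂ] ℂ, IsMarkovTrace τ := by
  obtain ⟨k, hk, hτ, normalized⟩ := isFaithfulTrace_haarFunctional.exists_normalized
    (isStarSubalgebra_hypercenter (A := A)) fun x hx => hypercenter_comm hx
  exact ⟨_, isRegularCondExp_haarEL.isMarkovTraceFor hk.1.1 (hypercenter_comm hk) hτ fun _ => rfl,
    isRegularCondExp_haarER.isMarkovTraceFor hk.1.2 (hypercenter_comm hk) hτ fun _ => rfl,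
    normalized⟩

lemma exists_isHyperSector_mul_eq {z : A} (hz : IsMinProj (zL A) z) :
    ∃ H, IsHyperSector H ∧ H * z = z := by
  obtain ⟨H, hH, hHz⟩ : ∃ H, IsHyperSector H ∧ H * z ≠ 0 := by
    by_contra! h0
    exact hz.ne_zero (eq_zero_of_forall_isMinProj_mul isStarSubalgebra_hypercenter h0)
  refine ⟨H, hH, (hz.mul_eq_zero_or_mul_eq hH.isStarProjection ?_
    (hypercenter_comm hH.mem z)).resolve_left hHz⟩
  exact (isStarSubalgebra_left.inf .center).mul_mem _ ⟨hH.mem.1.1, hH.mem.2⟩ _ hz.mem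

theorem IsVacuum.exists_isHyperSector {e : A} (he : IsVacuum e) :
    ∃ (z H : A) (k : ℕ), IsLeftVacuumProj e z ∧ IsHyperSector H ∧ H * z = z ∧
      haarIndex * H = (k : ℂ) • H ∧
      Module.finrank ℂ ((leftSub A).map (LinearMap.mulLeft ℂ z)) ≠ 0 ∧
      Module.finrank ℂ (LinearMap.range (LinearMap.mulLeft ℂ z)) =
        k * Module.finrank ℂ ((leftSub A).map (LinearMap.mulLeft ℂ z)) := by
  have hz := he.isLeftVacuumProj
  obtain ⟨H, hH, hHz⟩ := exists_isHyperSector_mul_eq hz.1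
  obtain ⟨k, hk⟩ := hH.exists_haarIndex_mul_eq
  refine ⟨_, H, k, hz, hH, hHz, hk,
    isRegularCondExp_haarEL.finrank_map_ne_zero hz.1.mem.1 hz.1.isStarProjection hz.1.ne_zero,
    finrank_range_mulLeft_eq_nat_mul hz.1.mem.1 hz.1.mul_self ?_⟩
  rw [← hHz, ← mul_assoc, hk, smul_mul_assoc]

theorem IsPure.finrank_left_dvd (hA : IsPure A) :
    Module.finrank ℂ (leftSub A) ∣ Module.finrank ℂ A := by
  rcases subsingleton_or_nontrivial A with _ | _
  · simp [Module.finrank_zero_of_subsingleton]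
  have one_isHyperSector : IsHyperSector (1 : A) :=
    ⟨isStarSubalgebra_hypercenter.one_mem, .one A, one_ne_zero, fun q hq hqp _ =>
      hA.eq_zero_or_eq_one ⟨hq.1.1, hq.2⟩ hqp.isIdempotentElem⟩
  obtain ⟨k, hk⟩ := one_isHyperSector.exists_haarIndex_mul_eq
  have finrank_eq := finrank_range_mulLeft_eq_nat_mul one_mem_left (one_mul 1) hk
  rw [LinearMap.mulLeft_one, LinearMap.range_id, finrank_top, Submodule.map_id] at finrank_eq
  exact ⟨k, by rw [finrank_eq, mul_comm]⟩

end Vacuum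

end WeakKac

end

theorem mainTheorem2 (A : Type*) [CStarAlgebra A] [Coalgebra ℂ A] [WeakKac.WeakKacAlgebra A] :
    (∃ h : A →ₗ[ℂ] ℂ, WeakKac.IsHaarFunctional h) ∧
    (∃ τ : A →ₗ[ℂ] ℂ, WeakKac.IsMarkovTrace τ) ∧
    (∃ I ∈ WeakKac.hypercenter A,
      (∀ h : A →ₗ[ℂ] ℂ, WeakKac.IsHaarFunctional h →
        WeakKac.HasIndex (WeakKac.leftSub A) (WeakKac.haarEL h) I ∧
        WeakKac.HasIndex (WeakKac.rightSub A) (WeakKac.haarER h) I) ∧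
      (∀ τ : A →ₗ[ℂ] ℂ, WeakKac.IsMarkovTrace τ →
        (∃ E, WeakKac.IsPreservingCondExp (WeakKac.leftSub A) τ E ∧
          WeakKac.HasIndex (WeakKac.leftSub A) E I) ∧
        (∃ E, WeakKac.IsPreservingCondExp (WeakKac.rightSub A) τ E ∧
          WeakKac.HasIndex (WeakKac.rightSub A) E I)) ∧
      (∀ H : A, WeakKac.IsHyperSector H → ∃ k : ℕ, I * H = (k : ℂ) • H) ∧
      (∀ μ : A, WeakKac.IsVacuum μ →
        ∃ (z H : A) (k : ℕ), WeakKac.IsLeftVacuumProj μ z ∧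
          WeakKac.IsHyperSector H ∧ H * z = z ∧ I * H = (k : ℂ) • H ∧
          Module.finrank ℂ ((WeakKac.leftSub A).map (LinearMap.mulLeft ℂ z)) ≠ 0 ∧
          Module.finrank ℂ (LinearMap.range (LinearMap.mulLeft ℂ z)) =
            k * Module.finrank ℂ ((WeakKac.leftSub A).map (LinearMap.mulLeft ℂ z)))) ∧
    (WeakKac.IsPure A →
      Module.finrank ℂ (WeakKac.leftSub A) ∣ Module.finrank ℂ A) := by
  refine ⟨⟨_, WeakKac.isHaarFunctional_haarFunctional⟩, WeakKac.exists_isMarkovTrace,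
    ⟨WeakKac.haarIndex, WeakKac.haarIndex_mem WeakKac.antipode_involutive, fun h hh => ?_,
      fun τ hτ => ⟨?_, ?_⟩, fun H hH => hH.exists_haarIndex_mul_eq,
      fun μ hμ => hμ.exists_isHyperSector⟩, fun hA => hA.finrank_left_dvd⟩
  · rw [hh.unique WeakKac.isHaarFunctional_haarFunctional]
    exact ⟨WeakKac.isRegularCondExp_haarEL.hasIndex, WeakKac.isRegularCondExp_haarER.hasIndex⟩
  · have hE := WeakKac.isRegularCondExp_haarEL (A := A)
    exact ⟨_, hE.isPreservingCondExp_of_isMarkovTraceFor hτ.left, hE.hasIndex⟩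
  · have hE := WeakKac.isRegularCondExp_haarER (A := A)
    exact ⟨_, hE.isPreservingCondExp_of_isMarkovTraceFor hτ.right, hE.hasIndex⟩
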